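/- **Theorem 2.1.** Let $v_0,\dots,v_n$ be a convex chain on a sphere $\mathcal S$ of radius $R>0$, and let $v_0',\dots,v_n'$ be a convex chain in the Euclidean plane with the same edge lengths and angles: for $1\le i\le n$ the Euclidean distance $|v_{i-1}'v_i'|$ equals the geodesic distance $d_{\mathcal S}(v_{i-1},v_i)$, and for $1\le i\le n-1$ the angle $\angle v_{i-1}'v_i'v_{i+1}'\in[0,\pi]$ equals the angle at $v_i$ between the great-circle arcs $v_iv_{i-1}$ and $v_iv_{i+1}$. Then the endpoints of the planar chain are strictly farther apart than those of the spherical chain: $$|v_0'v_n'| > d_{\mathcal S}(v_0,v_n).$$ Here $d_{\mathcal S}$ is the great-circle distance on $\mathcal S$. A chain is *convex* if the closed polygon obtained by adding the edge $v_nv_0$ is a convex polygon, that is: its vertices are pairwise distinct and do not all lie on one line (on the sphere: on one great circle), and, when the polygon is traversed in the given order, all vertices lie weakly on one and the same side (always left or always right) of the line (great circle) through each edge; straight angles $\theta_i=\pi$ are allowed. On the sphere, consecutive vertices of the closed polygon are not antipodal and each edge is the shorter great-circle arc between its endpoints. -/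

import Mathlib

/-- The Euclidean plane. -/
abbrev Plane : Type := EuclideanSpace ℝ (Fin 2)

/-- Euclidean three-space. -/
abbrev Space : Type := EuclideanSpace ℝ (Fin 3)

/-- The sphere of radius `R` centred at the origin of three-space. -/
abbrev Sphere (R : ℝ) : Type := Metric.sphere (0 : Space) R

/-- Twice the signed area of the planar triangle `a b c`: it is positive, zero or negative
according as `c` lies to the left of, on, or to the right of the line directed from `a` to `b`. -/
def planeSide (a b c : Plane) : ℝ :=
  (b 0 - a 0) * (c 1 - a 1) - (b 1 - a 1) * (c 0 - a 0)

/-- The determinant of three vectors of three-space: for points of a sphere, it is positive, zero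
or negative according as `c` lies to the left of, on, or to the right of the great circle directed
from `a` to `b` along their shorter arc. -/
noncomputable def sphereSide (a b c : Space) : ℝ :=
  Matrix.det (Matrix.of fun i j : Fin 3 => (![a, b, c] i) j)

/-- The geodesic (great-circle) distance on the sphere of radius `R`. -/
noncomputable def sphereDist {R : ℝ} (a b : Sphere R) : ℝ :=
  R * InnerProductGeometry.angle (a : Space) (b : Space)

/-- The component of `a` in the tangent plane at `p` of the sphere centred at the origin through
`p`. If `a` lies on that sphere and `a ≠ p`, `a ≠ -p`, it is a positive multiple of the initial
velocity at `p` of the shorter great-circle arc from `p` to `a`. -/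
noncomputable def tangentPart (p a : Space) : Space :=
  a - (inner ℝ p a / inner ℝ p p) • p

/-- The angle at `p` between the great-circle arcs from `p` to `a` and from `p` to `b`: the angle
in `[0, π]` between the tangent vectors of the two arcs. -/
noncomputable def sphereAngle {R : ℝ} (a p b : Sphere R) : ℝ :=
  InnerProductGeometry.angle (tangentPart (p : Space) (a : Space))
    (tangentPart (p : Space) (b : Space))

/-- The chain `v 0, …, v n` in the plane is convex: the closed polygon obtained by adding the edge
from `v n` to `v 0` is a convex polygon. That is, its vertices are distinct and not all on one
line, and traversing the polygon in its given order, the whole polygon stays weakly on one and the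
same side of the line through each edge. Straight angles are allowed.
(The index `i + 1` is taken cyclically modulo `n + 1`.) -/
structure IsConvexPlaneChain {n : ℕ} (v : Fin (n + 1) → Plane) : Prop where
  injective : Function.Injective v
  nondegenerate : ¬ Collinear ℝ (Set.range v)
  convex : (∀ i j, 0 ≤ planeSide (v i) (v (i + 1)) (v j)) ∨
    (∀ i j, planeSide (v i) (v (i + 1)) (v j) ≤ 0)

/-- The chain `v 0, …, v n` on the sphere of radius `R` is convex: the closed spherical polygon
obtained by adding the edge from `v n` to `v 0` is a convex polygon. That is, its vertices are
distinct, no two consecutive ones are antipodal (so that each edge is a well-defined shorter arc of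
a great circle), the vertices are not all on one great circle, and traversing the polygon in its
given order, the whole polygon stays weakly on one and the same side of the great circle through
each edge. Straight angles are allowed.
(The index `i + 1` is taken cyclically modulo `n + 1`.) -/
structure IsConvexSphereChain {R : ℝ} {n : ℕ} (v : Fin (n + 1) → Sphere R) : Prop where
  injective : Function.Injective v
  not_antipodal : ∀ i, (v (i + 1) : Space) ≠ -(v i : Space)
  nondegenerate : ∃ i j k, sphereSide (v i) (v j) (v k) ≠ 0
  convex : (∀ i j, 0 ≤ sphereSide (v i) (v (i + 1)) (v j)) ∨
    (∀ i j, sphereSide (v i) (v (i + 1)) (v j) ≤ 0)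

/-! ### Determinants, tangent vectors and additivity of angles at a point of the sphere -/

section

open InnerProductGeometry

/-! The spherical polygon is compared with a closed planar polygon having the same edge lengths,
closing edge included. Some inner vertex of the chain has angle less than `π`
(`exists_sphereSide_succ_ne_zero`). Cut the spherical polygon into triangles by diagonals from this
apex, replace each by the planar triangle with the same sides, and glue these around the apex. A
hinge comparison (`sq_lt_of_cos_eq`), resting on the strict convexity of `u ↦ cos √u`, shows that
planar angles are at most the spherical ones. Adding them at each vertex, the glued polygon has
angles no larger than the spherical polygon at every inner vertex of the chain
(`prevAngle_add_nextAngle_le`), and strictly smaller at the apex (`fanSum_last_lt`).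

The given planar chain therefore turns at most as much as the corresponding arm of the glued
polygon, and strictly less at one vertex. Cauchy's arm lemma (`sum_mul_cos_lt_dist`) then makes its
endpoints strictly farther apart than those of the glued arm, whose distance is the spherical one.
The arm lemma is proved by projection: measured from a suitable axis, each edge of the straighter
chain makes a smaller angle than the matching edge of the glued arm makes with its chord, so each
edge projects at least as far. -/

theorem sphereSide_eq (a b c : Space) :
    sphereSide a b c = a 0 * (b 1 * c 2 - b 2 * c 1) - a 1 * (b 0 * c 2 - b 2 * c 0)
      + a 2 * (b 0 * c 1 - b 1 * c 0) := by
  simp [sphereSide, Matrix.det_fin_three]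
  ring

theorem inner_space (x y : Space) : inner ℝ x y = x 0 * y 0 + x 1 * y 1 + x 2 * y 2 := by
  simp [PiLp.inner_apply, Fin.sum_univ_three, mul_comm]

theorem sphereSide_smul (s : ℝ) (a b c : Space) :
    sphereSide (s • a) (s • b) (s • c) = s ^ 3 * sphereSide a b c := by
  simp [sphereSide_eq]
  ring

theorem sphereSide_rotate (a b c : Space) : sphereSide a b c = sphereSide b c a := by
  simp only [sphereSide_eq]
  ring

theorem sphereSide_swap (a b c : Space) : sphereSide a b c = -sphereSide a c b := by
  simp only [sphereSide_eq]
  ring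

theorem sphereSide_neg_left (a b c : Space) : sphereSide (-a) b c = -sphereSide a b c := by
  simp [sphereSide_eq]
  ring

theorem inner_tangentPart {p : Space} (hp : ‖p‖ = 1) (x y : Space) :
    inner ℝ (tangentPart p x) (tangentPart p y) = inner ℝ x y - inner ℝ p x * inner ℝ p y := by
  have h : inner ℝ p p = (1 : ℝ) := by rw [real_inner_self_eq_norm_sq, hp]; norm_num
  simp only [tangentPart, inner_sub_left, inner_sub_right, inner_smul_left, inner_smul_right, h,
    real_inner_comm p x]
  simp

theorem inner_tangentPart_self {p : Space} (hp : ‖p‖ = 1) (x : Space) :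
    inner ℝ p (tangentPart p x) = 0 := by
  have h : inner ℝ p p = (1 : ℝ) := by rw [real_inner_self_eq_norm_sq, hp]; norm_num
  rw [tangentPart, inner_sub_right, inner_smul_right, h]
  simp

theorem sphereSide_tangentPart (p x y : Space) :
    sphereSide p (tangentPart p x) (tangentPart p y) = sphereSide p x y := by
  simp [sphereSide_eq, tangentPart]
  ring

theorem tangentPart_smul {s : ℝ} (hs : s ≠ 0) (p x : Space) :
    tangentPart (s • p) (s • x) = s • tangentPart p x := by
  simp only [tangentPart, inner_smul_left, inner_smul_right, smul_sub, smul_smul]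
  congr 2
  simp only [conj_trivial]
  field_simp

theorem cos_angle_unit {x y : Space} (hx : ‖x‖ = 1) (hy : ‖y‖ = 1) :
    Real.cos (angle x y) = inner ℝ x y := by
  rw [cos_angle, hx, hy]; simp

theorem norm_tangentPart {p x : Space} (hp : ‖p‖ = 1) (hx : ‖x‖ = 1) :
    ‖tangentPart p x‖ = Real.sin (angle p x) := by
  have h1 : ‖tangentPart p x‖ ^ 2 = Real.sin (angle p x) ^ 2 := by
    rw [← real_inner_self_eq_norm_sq, inner_tangentPart hp, Real.sin_sq, cos_angle_unit hp hx,
      real_inner_self_eq_norm_sq, hx]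
    ring
  exact (pow_left_inj₀ (norm_nonneg _) (sin_angle_nonneg _ _) two_ne_zero).1 h1

/-- The spherical law of cosines. -/
theorem cos_mul_sin_mul_sin {p x y : Space} (hp : ‖p‖ = 1) (hx : ‖x‖ = 1) (hy : ‖y‖ = 1) :
    Real.cos (angle x y) = Real.cos (angle p x) * Real.cos (angle p y) +
      Real.cos (angle (tangentPart p x) (tangentPart p y)) *
        (Real.sin (angle p x) * Real.sin (angle p y)) := by
  rw [← norm_tangentPart hp hx, ← norm_tangentPart hp hy, cos_angle_mul_norm_mul_norm,
    inner_tangentPart hp, cos_angle_unit hx hy, cos_angle_unit hp hx, cos_angle_unit hp hy]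
  ring

/-- On the plane orthogonal to a unit vector `p`, `sphereSide p` is the planar cross product. The
usual identities between cross and dot products hold in space with correction terms that contain an
inner product with `p`, and these vanish here. -/
theorem sphereSide_sq {p a b : Space} (hp : ‖p‖ = 1) (ha : inner ℝ p a = (0 : ℝ))
    (hb : inner ℝ p b = (0 : ℝ)) :
    sphereSide p a b ^ 2 = inner ℝ a a * inner ℝ b b - inner ℝ a b ^ 2 := by
  have h : inner ℝ p p = (1 : ℝ) := by rw [real_inner_self_eq_norm_sq, hp]; norm_num
  have key : sphereSide p a b ^ 2 = inner ℝ p p * (inner ℝ a a * inner ℝ b b - inner ℝ a b ^ 2)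
      - inner ℝ p a * (inner ℝ p a * inner ℝ b b - inner ℝ p b * inner ℝ a b)
      + inner ℝ p b * (inner ℝ p a * inner ℝ a b - inner ℝ p b * inner ℝ a a) := by
    simp only [sphereSide_eq, inner_space]
    ring
  rw [key, h, ha, hb]; ring

theorem sphereSide_mul_sphereSide {p a b c : Space} (hp : ‖p‖ = 1)
    (hb : inner ℝ p b = (0 : ℝ)) (hc : inner ℝ p c = (0 : ℝ)) :
    sphereSide p a b * sphereSide p b c = inner ℝ a b * inner ℝ b c - inner ℝ a c * inner ℝ b b := by
  have h : inner ℝ p p = (1 : ℝ) := by rw [real_inner_self_eq_norm_sq, hp]; norm_num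
  have key : sphereSide p a b * sphereSide p b c =
      inner ℝ p p * (inner ℝ a b * inner ℝ b c - inner ℝ a c * inner ℝ b b)
      - inner ℝ p b * (inner ℝ p a * inner ℝ b c - inner ℝ a c * inner ℝ p b)
      + inner ℝ p c * (inner ℝ p a * inner ℝ b b - inner ℝ a b * inner ℝ p b) := by
    simp only [sphereSide_eq, inner_space]
    ring
  rw [key, h, hb, hc]; ring

theorem sphereSide_mul_inner {p a b c : Space} (hb : inner ℝ p b = (0 : ℝ)) :
    sphereSide p a c * inner ℝ b b =
      sphereSide p a b * inner ℝ b c + inner ℝ a b * sphereSide p b c := by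
  have key : sphereSide p a c * inner ℝ b b =
      sphereSide p a b * inner ℝ b c + inner ℝ a b * sphereSide p b c
      - sphereSide a b c * inner ℝ p b := by
    simp only [sphereSide_eq, inner_space]
    ring
  rw [key, hb]; ring

theorem sin_angle_mul_norm_mul_norm_eq_sphereSide {p a b : Space} (hp : ‖p‖ = 1)
    (ha : inner ℝ p a = (0 : ℝ)) (hb : inner ℝ p b = (0 : ℝ)) (h : 0 ≤ sphereSide p a b) :
    Real.sin (angle a b) * (‖a‖ * ‖b‖) = sphereSide p a b := by
  rw [sin_angle_mul_norm_mul_norm, ← pow_two, ← sphereSide_sq hp ha hb, Real.sqrt_sq h]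

/-- Additivity of angles between consecutive vectors of the plane orthogonal to `p`. -/
theorem angle_add_angle_of_sphereSide_nonneg {p a b c : Space} (hp : ‖p‖ = 1)
    (ha : inner ℝ p a = (0 : ℝ)) (hb : inner ℝ p b = (0 : ℝ)) (hc : inner ℝ p c = (0 : ℝ))
    (ha0 : a ≠ 0) (hb0 : b ≠ 0) (hc0 : c ≠ 0)
    (hab : 0 ≤ sphereSide p a b) (hbc : 0 ≤ sphereSide p b c) (hac : 0 ≤ sphereSide p a c) :
    angle a b + angle b c = angle a c ∨ angle a b = Real.pi ∧ angle b c = Real.pi := by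
  have na : 0 < ‖a‖ := norm_pos_iff.2 ha0
  have nb : 0 < ‖b‖ := norm_pos_iff.2 hb0
  have nc : 0 < ‖c‖ := norm_pos_iff.2 hc0
  have s1 := sin_angle_mul_norm_mul_norm_eq_sphereSide hp ha hb hab
  have s2 := sin_angle_mul_norm_mul_norm_eq_sphereSide hp hb hc hbc
  have s3 := sin_angle_mul_norm_mul_norm_eq_sphereSide hp ha hc hac
  have c1 := cos_angle_mul_norm_mul_norm a b
  have c2 := cos_angle_mul_norm_mul_norm b c
  have c3 := cos_angle_mul_norm_mul_norm a c
  have k1 := sphereSide_mul_sphereSide (a := a) hp hb hc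
  have k2 := sphereSide_mul_inner (a := a) (c := c) hb
  rw [real_inner_self_eq_norm_sq, ← s1, ← s2, ← c1, ← c2] at k1 k2
  rw [← c3] at k1
  rw [← s3] at k2
  have hpos : 0 < ‖a‖ * ‖b‖ ^ 2 * ‖c‖ := by positivity
  -- Cosine and sine of the sum both agree with those of `angle a c`. A sum above `π` must then
  -- reach `2 * π`, since its sine is nonnegative; this does occur, when `b` is opposite to both `a`
  -- and `c`.
  have hcos : Real.cos (angle a b + angle b c) = Real.cos (angle a c) := by
    rw [Real.cos_add]
    apply mul_left_cancel₀ hpos.ne'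
    linear_combination -k1
  have hsin : Real.sin (angle a b + angle b c) = Real.sin (angle a c) := by
    rw [Real.sin_add]
    apply mul_left_cancel₀ hpos.ne'
    linear_combination -k2
  have b1 := angle_le_pi a b
  have b2 := angle_le_pi b c
  have b1' := angle_nonneg a b
  have b2' := angle_nonneg b c
  rcases le_or_gt (angle a b + angle b c) Real.pi with h | h
  · left
    exact Real.injOn_cos ⟨by linarith, h⟩ ⟨angle_nonneg _ _, angle_le_pi _ _⟩ hcos
  · right
    have hge : 2 * Real.pi ≤ angle a b + angle b c := by
      by_contra hlt
      have : Real.sin (angle a b + angle b c) < 0 := by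
        have h' := Real.sin_neg_of_neg_of_neg_pi_lt
          (x := angle a b + angle b c - 2 * Real.pi) (by linarith) (by linarith)
        rwa [Real.sin_sub_two_pi] at h'
      linarith [sin_angle_nonneg a c]
    exact ⟨by linarith, by linarith⟩

end

/-! ### The hinge comparison, and angles of planar triangles given by their sides -/

section

open Real

theorem sin_div_strictAnti {x y : ℝ} (hx : 0 < x) (hxy : x < y) (hy : y ≤ π) :
    sin y / y < sin x / x := by
  have h := strictConcaveOn_sin_Icc.2 (show (0 : ℝ) ∈ Set.Icc 0 π from ⟨le_rfl, pi_pos.le⟩)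
    (show y ∈ Set.Icc 0 π from ⟨by linarith, hy⟩) (by linarith)
    (show 0 < 1 - x / y by have := (div_lt_one (hx.trans hxy)).2 hxy; linarith)
    (show 0 < x / y from div_pos hx (hx.trans hxy)) (by ring)
  have hy0 : 0 < y := hx.trans hxy
  simp only [smul_eq_mul, mul_zero, sin_zero, zero_add] at h
  rw [div_mul_cancel₀ _ hy0.ne'] at h
  rw [div_lt_div_iff₀ hy0 hx]
  rw [div_mul_eq_mul_div, div_lt_iff₀ hy0] at h
  linarith

/-- The derivative is `-(sin √u / √u) / 2`, which increases because `sin x / x` decreases on `(0,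
π]`. -/
theorem strictConvexOn_cos_sqrt : StrictConvexOn ℝ (Set.Icc 0 (π ^ 2)) fun u => cos √u := by
  have hd : ∀ x ∈ Set.Ioo 0 (π ^ 2), deriv (fun u => cos √u) x = -(sin √x / √x) / 2 := by
    intro x hx
    have h := ((hasDerivAt_cos √x).comp x ((hasDerivAt_sqrt hx.1.ne')))
    have h' : HasDerivAt (fun u => cos √u) (-sin √x * (1 / (2 * √x))) x := h
    rw [h'.deriv]
    have := (sqrt_pos.2 hx.1).ne'
    field_simp
  apply StrictMonoOn.strictConvexOn_of_deriv (convex_Icc _ _)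
  · fun_prop
  · rw [interior_Icc]
    intro x hx y hy hxy
    rw [hd x hx, hd y hy]
    have := sin_div_strictAnti (sqrt_pos.2 hx.1) (sqrt_lt_sqrt hx.1.le hxy)
      ((sqrt_le_left pi_pos.le).2 hy.2.le)
    linarith

/-- The hinge comparison between spherical and planar triangles, strict form. -/
theorem sq_lt_of_cos_eq {a b c t : ℝ} (ha : 0 < a) (ha' : a < π) (hb : 0 < b) (hb' : b < π)
    (hc : 0 ≤ c) (hc' : c ≤ π) (ht : -1 < t) (ht' : t < 1)
    (h : cos c = cos a * cos b + t * (sin a * sin b)) :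
    c ^ 2 < a ^ 2 + b ^ 2 - 2 * a * b * t := by
  have hab : 0 < a * b := mul_pos ha hb
  have hs : 0 < sin a * sin b := mul_pos (sin_pos_of_pos_of_lt_pi ha ha')
    (sin_pos_of_pos_of_lt_pi hb hb')
  have hcp : c < π := by
    refine lt_of_le_of_ne hc' fun hcpi => ?_
    rw [hcpi, cos_pi] at h
    have h2 := neg_one_le_cos (a + b)
    rw [cos_add] at h2
    nlinarith
  by_contra hcon
  push Not at hcon
  -- With `a` and `b` fixed, `t` is affine in the squared planar side `u`, hence so is the right
  -- side of `h`. It agrees with `cos √u` at `u₁`, where `t = 1`, and is at least `cos √u` at some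
  -- `u₂` beyond `u`. Strict convexity then gives `cos √u < cos c`, against `hcos_c`.
  set u := a ^ 2 + b ^ 2 - 2 * a * b * t with hu
  set u₁ := (a - b) ^ 2 with hu₁
  have hu₁u : u₁ < u := by nlinarith
  have hcpi2 : c ^ 2 < π ^ 2 := by nlinarith
  have hcos_c : cos c ≤ cos √u := by
    apply cos_le_cos_of_nonneg_of_le_pi (sqrt_nonneg _) hc'
    exact (sqrt_le_left hc).2 hcon
  obtain ⟨u₂, hu₂, huu₂, hle⟩ : ∃ u₂, u₂ ≤ π ^ 2 ∧ u < u₂ ∧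
      cos √u₂ ≤ cos a * cos b + (a ^ 2 + b ^ 2 - u₂) / (2 * (a * b)) * (sin a * sin b) := by
    -- The natural right endpoint `(a + b) ^ 2`, where `t = -1`, may leave the interval of
    -- convexity. It is then replaced by `π ^ 2`, where the cosine is `-1`, a lower bound for the
    -- affine side.
    rcases le_or_gt (a + b) π with hle | hgt
    · refine ⟨(a + b) ^ 2, by nlinarith, by nlinarith, ?_⟩
      rw [sqrt_sq (by linarith), cos_add]
      have : (a ^ 2 + b ^ 2 - (a + b) ^ 2) / (2 * (a * b)) = -1 := by field_simp; ring
      rw [this]; linarith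
    · refine ⟨π ^ 2, le_rfl, by linarith, ?_⟩
      rw [sqrt_sq pi_pos.le, cos_pi]
      have h3 : -1 ≤ (a ^ 2 + b ^ 2 - π ^ 2) / (2 * (a * b)) := by
        rw [le_div_iff₀ (by linarith)]; nlinarith
      have h2 := neg_one_le_cos (a + b)
      rw [cos_add] at h2
      nlinarith
  have hd : 0 < u₂ - u₁ := by linarith
  have hconv := strictConvexOn_cos_sqrt.2
    (show u₁ ∈ Set.Icc 0 (π ^ 2) from ⟨sq_nonneg _, by linarith⟩)
    (show u₂ ∈ Set.Icc 0 (π ^ 2) from ⟨by nlinarith [sq_nonneg (a - b)], hu₂⟩) (by linarith)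
    (show 0 < (u₂ - u) / (u₂ - u₁) from div_pos (by linarith) hd)
    (show 0 < (u - u₁) / (u₂ - u₁) from div_pos (by linarith) hd) (by field_simp; ring)
  have hmid : ((u₂ - u) / (u₂ - u₁)) • u₁ + ((u - u₁) / (u₂ - u₁)) • u₂ = u := by
    simp only [smul_eq_mul]; field_simp; ring
  rw [hmid] at hconv
  simp only [smul_eq_mul] at hconv
  have h1 : cos √u₁ = cos a * cos b + sin a * sin b := by
    rw [hu₁, sqrt_sq_eq_abs, cos_abs, cos_sub]
  rw [h1] at hconv
  have hw : 0 ≤ (u - u₁) / (u₂ - u₁) := (div_pos (by linarith) hd).le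
  have h4 := mul_le_mul_of_nonneg_left hle hw
  have h5 : (u₂ - u) / (u₂ - u₁) * (cos a * cos b + sin a * sin b) + (u - u₁) / (u₂ - u₁) *
      (cos a * cos b + (a ^ 2 + b ^ 2 - u₂) / (2 * (a * b)) * (sin a * sin b))
      = cos a * cos b + t * (sin a * sin b) := by
    have e1 : (a ^ 2 + b ^ 2 - u₂) / (2 * (a * b)) = 1 - (u₂ - u₁) / (2 * (a * b)) := by
      rw [hu₁]; field_simp; ring
    have e2 : t = 1 - (u - u₁) / (2 * (a * b)) := by
      rw [hu₁, hu]; field_simp; ring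
    rw [e1, e2]
    field_simp
    ring
  linarith

theorem sq_le_of_cos_eq {a b c t : ℝ} (ha : 0 < a) (ha' : a < π) (hb : 0 < b) (hb' : b < π)
    (hc : 0 ≤ c) (hc' : c ≤ π) (ht : -1 ≤ t) (ht' : t ≤ 1)
    (h : cos c = cos a * cos b + t * (sin a * sin b)) :
    c ^ 2 ≤ a ^ 2 + b ^ 2 - 2 * a * b * t := by
  rcases ht.eq_or_lt with rfl | ht
  -- Here `a + b` may exceed `π`, so only `c ≤ a + b` is available, not equality.
  · have h1 : cos c = cos (a + b) := by rw [h, cos_add]; ring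
    have : c ≤ a + b := by
      by_contra hlt
      push Not at hlt
      have := strictAntiOn_cos ⟨by linarith, by linarith⟩ ⟨hc, hc'⟩ hlt
      linarith
    nlinarith
  rcases ht'.eq_or_lt with rfl | ht'
  · have h1 : cos c = cos |a - b| := by rw [h, cos_abs, cos_sub]; ring
    have : c = |a - b| := injOn_cos ⟨hc, hc'⟩
      ⟨abs_nonneg _, abs_le.2 ⟨by linarith, by linarith⟩⟩ h1
    rw [this, sq_abs]; linarith
  · exact (sq_lt_of_cos_eq ha ha' hb hb' hc hc' ht ht' h).le

/-- The angle, between the sides of lengths `a` and `b`, of a planar triangle whose third side has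
length `c`. -/
noncomputable def planarAngle (a b c : ℝ) : ℝ := arccos ((a ^ 2 + b ^ 2 - c ^ 2) / (2 * a * b))

theorem planarAngle_comm (a b c : ℝ) : planarAngle a b c = planarAngle b a c := by
  unfold planarAngle
  congr 1
  ring

theorem planarAngle_nonneg (a b c : ℝ) : 0 ≤ planarAngle a b c := arccos_nonneg _

theorem planarAngle_le_pi (a b c : ℝ) : planarAngle a b c ≤ π := arccos_le_pi _

theorem planarAngle_add_eq_zero {a b : ℝ} (ha : 0 < a) (hb : 0 < b) :
    planarAngle (a + b) a b = 0 := by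
  unfold planarAngle
  rw [arccos_eq_zero, le_div_iff₀ (by positivity)]
  nlinarith

theorem cos_planarAngle {a b c : ℝ} (ha : 0 < a) (hb : 0 < b) (hc : 0 ≤ c) (h1 : c ≤ a + b)
    (h2 : a ≤ b + c) (h3 : b ≤ c + a) :
    2 * a * b * cos (planarAngle a b c) = a ^ 2 + b ^ 2 - c ^ 2 := by
  unfold planarAngle
  rw [cos_arccos]
  · field_simp
  · rw [le_div_iff₀ (by positivity)]; nlinarith
  · rw [div_le_iff₀ (by positivity)]; nlinarith [mul_nonneg (sub_nonneg.2 h2) (sub_nonneg.2 h3)]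

/-- Two sides of a triangle project onto the third and fill it; `mul_sin_planarAngle` equates their
heights over it. -/
theorem mul_cos_planarAngle {a b c : ℝ} (ha : 0 < a) (hb : 0 < b) (hc : 0 < c) (h1 : c ≤ a + b)
    (h2 : a ≤ b + c) (h3 : b ≤ c + a) :
    b * cos (planarAngle a b c) + c * cos (planarAngle a c b) = a := by
  have e1 := cos_planarAngle ha hb hc.le h1 h2 h3
  have e2 := cos_planarAngle ha hc hb.le (by linarith) (by linarith) (by linarith)
  apply mul_left_cancel₀ (by positivity : 2 * a ≠ 0)
  linear_combination e1 + e2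

theorem mul_sin_planarAngle {a b c : ℝ} (ha : 0 < a) (hb : 0 < b) (hc : 0 < c) (h1 : c ≤ a + b)
    (h2 : a ≤ b + c) (h3 : b ≤ c + a) :
    b * sin (planarAngle a b c) = c * sin (planarAngle a c b) := by
  have hs1 : 0 ≤ sin (planarAngle a b c) :=
    sin_nonneg_of_nonneg_of_le_pi (planarAngle_nonneg _ _ _) (planarAngle_le_pi _ _ _)
  have hs2 : 0 ≤ sin (planarAngle a c b) :=
    sin_nonneg_of_nonneg_of_le_pi (planarAngle_nonneg _ _ _) (planarAngle_le_pi _ _ _)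
  have e0 := mul_cos_planarAngle ha hb hc h1 h2 h3
  have e1 := cos_planarAngle ha hb hc.le h1 h2 h3
  have e2 := sin_sq_add_cos_sq (planarAngle a b c)
  have e3 := sin_sq_add_cos_sq (planarAngle a c b)
  refine (pow_left_inj₀ (by positivity) (by positivity) two_ne_zero).1 ?_
  have e4 : c * cos (planarAngle a c b) = a - b * cos (planarAngle a b c) := by linarith
  have e5 : (c * cos (planarAngle a c b)) ^ 2 = (a - b * cos (planarAngle a b c)) ^ 2 := by rw [e4]
  linear_combination b ^ 2 * e2 - c ^ 2 * e3 + e5 - e1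

theorem planarAngle_sum {a b c : ℝ} (ha : 0 < a) (hb : 0 < b) (hc : 0 < c) (h1 : c ≤ a + b)
    (h2 : a ≤ b + c) (h3 : b ≤ c + a) :
    planarAngle a b c + planarAngle b c a + planarAngle a c b = π := by
  set A := planarAngle a b c with hA
  set B := planarAngle b c a with hB
  set C := planarAngle a c b with hC
  have c1 : b * cos A + c * cos C = a := mul_cos_planarAngle ha hb hc h1 h2 h3
  have s1 : b * sin A = c * sin C := mul_sin_planarAngle ha hb hc h1 h2 h3
  have c2 : a * cos A + c * cos B = b := by
    have := mul_cos_planarAngle hb ha hc (by linarith) (by linarith) (by linarith)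
    rwa [planarAngle_comm b a] at this
  have s2 : a * sin A = c * sin B := by
    have := mul_sin_planarAngle hb ha hc (by linarith) (by linarith) (by linarith)
    rwa [planarAngle_comm b a] at this
  have p := sin_sq_add_cos_sq A
  have hcos : cos (A + B) = -cos C := by
    rw [cos_add]
    apply mul_left_cancel₀ hc.ne'
    linear_combination cos A * c2 + sin A * s2 - a * p + c1
  have hsin : sin (A + B) = sin C := by
    rw [sin_add]
    apply mul_left_cancel₀ hc.ne'
    linear_combination sin A * c2 - cos A * s2 + s1
  have hA0 : 0 ≤ A := planarAngle_nonneg _ _ _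
  have hB0 : 0 ≤ B := planarAngle_nonneg _ _ _
  have hA1 : A ≤ π := planarAngle_le_pi _ _ _
  have hB1 : B ≤ π := planarAngle_le_pi _ _ _
  have hC0 : 0 ≤ C := planarAngle_nonneg _ _ _
  have hC1 : C ≤ π := planarAngle_le_pi _ _ _
  rcases le_or_gt (A + B) π with h | h
  · have : A + B = π - C := injOn_cos ⟨by linarith, h⟩ ⟨by linarith, by linarith⟩
      (by rw [hcos, cos_pi_sub])
    linarith
  · have hge : 2 * π ≤ A + B := by
      by_contra hlt
      have : sin (A + B) < 0 := by
        have h' := sin_neg_of_neg_of_neg_pi_lt (x := A + B - 2 * π) (by linarith) (by linarith)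
        rwa [sin_sub_two_pi] at h'
      linarith [sin_nonneg_of_nonneg_of_le_pi hC0 hC1]
    have hAp : A = π := by linarith
    have hBp : B = π := by linarith
    rw [hAp, hBp, cos_pi] at c2
    rw [hAp, cos_pi] at c1
    nlinarith [neg_one_le_cos C, cos_le_one C]

end

/-! ### Spherical angles dominate planar ones; incidence with great circles -/

section

open InnerProductGeometry

theorem angle_pos_of_ne {x y : Space} (hx : ‖x‖ = 1) (hy : ‖y‖ = 1) (h : y ≠ x) :
    0 < angle x y := by
  refine lt_of_le_of_ne (angle_nonneg _ _) fun h0 => h ?_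
  have := (inner_eq_one_iff_of_norm_eq_one (𝕜 := ℝ) hx hy).1
    (by rw [← cos_angle_unit hx hy, ← h0, Real.cos_zero])
  exact this.symm

theorem angle_lt_pi_of_ne_neg {x y : Space} (hx : ‖x‖ = 1) (hy : ‖y‖ = 1) (h : y ≠ -x) :
    angle x y < Real.pi := by
  have h1 := angle_pos_of_ne (x := -x) (by rwa [norm_neg]) hy h
  rw [angle_neg_left] at h1
  linarith

theorem tangentPart_ne_zero {p x : Space} (hp : ‖p‖ = 1) (hx : ‖x‖ = 1) (h : x ≠ p)
    (h' : x ≠ -p) : tangentPart p x ≠ 0 := by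
  rw [← norm_pos_iff, norm_tangentPart hp hx]
  exact Real.sin_pos_of_pos_of_lt_pi (angle_pos_of_ne hp hx h) (angle_lt_pi_of_ne_neg hp hx h')

/-- The angles of a spherical triangle are at least those of the planar triangle with the same
side lengths. -/
theorem planarAngle_le_angle {p x y : Space} (hp : ‖p‖ = 1) (hx : ‖x‖ = 1) (hy : ‖y‖ = 1)
    (hxp : x ≠ p) (hxp' : x ≠ -p) (hyp : y ≠ p) (hyp' : y ≠ -p) :
    planarAngle (angle p x) (angle p y) (angle x y) ≤
      angle (tangentPart p x) (tangentPart p y) := by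
  have ha := angle_pos_of_ne hp hx hxp
  have hb := angle_pos_of_ne hp hy hyp
  have h := sq_le_of_cos_eq ha (angle_lt_pi_of_ne_neg hp hx hxp') hb
    (angle_lt_pi_of_ne_neg hp hy hyp') (angle_nonneg x y) (angle_le_pi x y)
    (Real.neg_one_le_cos _) (Real.cos_le_one _) (cos_mul_sin_mul_sin hp hx hy)
  rw [← Real.arccos_cos (angle_nonneg (tangentPart p x) (tangentPart p y)) (angle_le_pi _ _)]
  apply Real.arccos_le_arccos
  rw [le_div_iff₀ (by positivity)]
  linarith

theorem planarAngle_lt_angle {p x y : Space} (hp : ‖p‖ = 1) (hx : ‖x‖ = 1) (hy : ‖y‖ = 1)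
    (hxp : x ≠ p) (hxp' : x ≠ -p) (hyp : y ≠ p) (hyp' : y ≠ -p)
    (h0 : 0 < angle (tangentPart p x) (tangentPart p y))
    (hpi : angle (tangentPart p x) (tangentPart p y) < Real.pi) :
    planarAngle (angle p x) (angle p y) (angle x y) <
      angle (tangentPart p x) (tangentPart p y) := by
  have ha := angle_pos_of_ne hp hx hxp
  have hb := angle_pos_of_ne hp hy hyp
  have ht : -1 < Real.cos (angle (tangentPart p x) (tangentPart p y)) := by
    rw [← Real.cos_pi]
    exact Real.cos_lt_cos_of_nonneg_of_le_pi h0.le le_rfl hpi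
  have ht' : Real.cos (angle (tangentPart p x) (tangentPart p y)) < 1 := by
    rw [← Real.cos_zero]
    exact Real.cos_lt_cos_of_nonneg_of_le_pi le_rfl hpi.le h0
  have h := sq_lt_of_cos_eq ha (angle_lt_pi_of_ne_neg hp hx hxp') hb
    (angle_lt_pi_of_ne_neg hp hy hyp') (angle_nonneg x y) (angle_le_pi x y)
    ht ht' (cos_mul_sin_mul_sin hp hx hy)
  have h1 : Real.cos (angle (tangentPart p x) (tangentPart p y)) <
      (angle p x ^ 2 + angle p y ^ 2 - angle x y ^ 2) / (2 * angle p x * angle p y) := by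
    rw [lt_div_iff₀ (by positivity)]
    linarith
  -- For a quotient above `1`, `arccos` takes the value `0` and `h0` suffices, so the triangle
  -- inequality need not be invoked.
  rcases le_or_gt ((angle p x ^ 2 + angle p y ^ 2 - angle x y ^ 2) /
    (2 * angle p x * angle p y)) 1 with h2 | h2
  · have := Real.arccos_lt_arccos ht.le h1 h2
    rwa [Real.arccos_cos h0.le hpi.le] at this
  · rwa [planarAngle, Real.arccos_of_one_le h2.le]

theorem angle_tangentPart_add {p x y z : Space} (hp : ‖p‖ = 1) (hx : ‖x‖ = 1) (hy : ‖y‖ = 1)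
    (hz : ‖z‖ = 1) (hxp : x ≠ p) (hxp' : x ≠ -p) (hyp : y ≠ p) (hyp' : y ≠ -p) (hzp : z ≠ p)
    (hzp' : z ≠ -p) (hxy : 0 ≤ sphereSide p x y) (hyz : 0 ≤ sphereSide p y z)
    (hxz : 0 ≤ sphereSide p x z) :
    angle (tangentPart p x) (tangentPart p y) + angle (tangentPart p y) (tangentPart p z) =
      angle (tangentPart p x) (tangentPart p z) ∨
    angle (tangentPart p x) (tangentPart p y) = Real.pi ∧
      angle (tangentPart p y) (tangentPart p z) = Real.pi := by
  apply angle_add_angle_of_sphereSide_nonneg hp (inner_tangentPart_self hp x)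
    (inner_tangentPart_self hp y) (inner_tangentPart_self hp z)
    (tangentPart_ne_zero hp hx hxp hxp') (tangentPart_ne_zero hp hy hyp hyp')
    (tangentPart_ne_zero hp hz hzp hzp') <;> rwa [sphereSide_tangentPart]

/-- Directions from `p` at angle `π` see all points on opposite sides. -/
theorem exists_neg_of_angle_tangentPart_eq_pi {p x y : Space}
    (h : angle (tangentPart p x) (tangentPart p y) = Real.pi) :
    ∃ r < 0, ∀ q, sphereSide p y q = r * sphereSide p x q := by
  obtain ⟨-, r, hr, he⟩ := angle_eq_pi_iff.1 h
  refine ⟨r, hr, fun q => ?_⟩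
  rw [← sphereSide_tangentPart p y q, he, ← sphereSide_tangentPart p x q]
  simp only [sphereSide_eq, PiLp.smul_apply, smul_eq_mul]
  ring

theorem sphereSide_tangentPart_pos_angle {p x y : Space} (h : sphereSide p x y ≠ 0) :
    0 < angle (tangentPart p x) (tangentPart p y) ∧
      angle (tangentPart p x) (tangentPart p y) < Real.pi := by
  constructor
  · refine lt_of_le_of_ne (angle_nonneg _ _) fun h0 => h ?_
    obtain ⟨-, r, -, he⟩ := angle_eq_zero_iff.1 h0.symm
    rw [← sphereSide_tangentPart, he]
    simp only [sphereSide_eq, PiLp.smul_apply, smul_eq_mul]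
    ring
  · refine lt_of_le_of_ne (angle_le_pi _ _) fun h0 => h ?_
    obtain ⟨-, r, -, he⟩ := angle_eq_pi_iff.1 h0
    rw [← sphereSide_tangentPart, he]
    simp only [sphereSide_eq, PiLp.smul_apply, smul_eq_mul]
    ring

/-- Two independent unit vectors span a plane, which cannot contain a basis. -/
theorem exists_sphereSide_ne_zero {a b x y z : Space} (ha : ‖a‖ = 1) (hb : ‖b‖ = 1) (hab : b ≠ a)
    (hab' : b ≠ -a) (h : sphereSide x y z ≠ 0) (hx : sphereSide a b x = 0)
    (hy : sphereSide a b y = 0) (hz : sphereSide a b z = 0) : False := by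
  have ha1 : inner ℝ a a = (1 : ℝ) := by rw [real_inner_self_eq_norm_sq, ha]; norm_num
  have hb1 : inner ℝ b b = (1 : ℝ) := by rw [real_inner_self_eq_norm_sq, hb]; norm_num
  have hn : 0 < 1 - inner ℝ a b ^ 2 := by
    rw [← cos_angle_unit ha hb, ← Real.sin_sq]
    exact pow_pos (Real.sin_pos_of_pos_of_lt_pi (angle_pos_of_ne ha hb hab)
      (angle_lt_pi_of_ne_neg ha hb hab')) 2
  -- The cross product of `a` and `b` is orthogonal to the basis `x, y, z`, so it vanishes by
  -- Cramer's rule, one component at a time. Yet its squared norm is `1 - inner ℝ a b ^ 2 > 0`.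
  have e0 : a 1 * b 2 - a 2 * b 1 = 0 := by
    refine (mul_eq_zero.1 ?_).resolve_left h
    simp only [sphereSide_eq] at hx hy hz ⊢
    linear_combination (y 1 * z 2 - y 2 * z 1) * hx + (z 1 * x 2 - z 2 * x 1) * hy
      + (x 1 * y 2 - x 2 * y 1) * hz
  have e1 : a 2 * b 0 - a 0 * b 2 = 0 := by
    refine (mul_eq_zero.1 ?_).resolve_left h
    simp only [sphereSide_eq] at hx hy hz ⊢
    linear_combination (y 2 * z 0 - y 0 * z 2) * hx + (z 2 * x 0 - z 0 * x 2) * hy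
      + (x 2 * y 0 - x 0 * y 2) * hz
  have e2 : a 0 * b 1 - a 1 * b 0 = 0 := by
    refine (mul_eq_zero.1 ?_).resolve_left h
    simp only [sphereSide_eq] at hx hy hz ⊢
    linear_combination (y 0 * z 1 - y 1 * z 0) * hx + (z 0 * x 1 - z 1 * x 0) * hy
      + (x 0 * y 1 - x 1 * y 0) * hz
  have key : inner ℝ a a * inner ℝ b b - inner ℝ a b ^ 2 = (a 1 * b 2 - a 2 * b 1) ^ 2
      + (a 2 * b 0 - a 0 * b 2) ^ 2 + (a 0 * b 1 - a 1 * b 0) ^ 2 := by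
    simp only [inner_space]; ring
  rw [ha1, hb1, e0, e1, e2] at key
  linarith

/-- If two independent points lie in the plane of `a` and `b`, then so does every point of their
own plane. -/
theorem sphereSide_eq_zero_of_sphereSide_eq_zero {a b x y z : Space} (hx1 : ‖x‖ = 1)
    (hy1 : ‖y‖ = 1) (hxy : y ≠ x) (hxy' : y ≠ -x) (hx : sphereSide a b x = 0)
    (hy : sphereSide a b y = 0) (h : sphereSide x y z = 0) : sphereSide a b z = 0 := by
  by_contra hz
  have hx2 : sphereSide x y x = 0 := by simp only [sphereSide_eq]; ring
  have hy2 : sphereSide x y y = 0 := by simp only [sphereSide_eq]; ring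
  have ha : sphereSide x y a = 0 := by
    refine (mul_eq_zero.1 ?_).resolve_left hz
    -- The Grassmann–Plücker exchange relation.
    have : sphereSide a b z * sphereSide x y a = sphereSide x y z * sphereSide a b a +
        sphereSide a b x * sphereSide z y a + sphereSide a b y * sphereSide x z a := by
      simp only [sphereSide_eq]; ring
    rw [this, hx, hy, h]; ring
  have hb : sphereSide x y b = 0 := by
    refine (mul_eq_zero.1 ?_).resolve_left hz
    have : sphereSide a b z * sphereSide x y b = sphereSide x y z * sphereSide a b b +
        sphereSide a b x * sphereSide z y b + sphereSide a b y * sphereSide x z b := by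
      simp only [sphereSide_eq]; ring
    rw [this, hx, hy, h]; ring
  exact exists_sphereSide_ne_zero hx1 hy1 hxy hxy' hz ha hb h

end

/-! ### The planar comparison polygon, glued from a fan of triangles -/

section

open InnerProductGeometry

/-- A closed convex polygon `u 0, …, u n` on the unit sphere, traversed counterclockwise, with an
interior angle less than `π` at `u 0`. -/
structure IsClosedConvexPolygon (n : ℕ) (u : ℕ → Space) : Prop where
  two_le : 2 ≤ n
  norm : ∀ k, ‖u k‖ = 1
  closed : u (n + 1) = u 0
  convex : ∀ k ≤ n, ∀ j, 0 ≤ sphereSide (u k) (u (k + 1)) (u j)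
  succ_ne : ∀ k ≤ n, u (k + 1) ≠ u k
  succ_ne_neg : ∀ k ≤ n, u (k + 1) ≠ -u k
  ne_zero : ∀ k, 1 ≤ k → k ≤ n → u k ≠ u 0
  pos : 0 < sphereSide (u n) (u 0) (u 1)

/-- The interior angle at `u (k + 1)`. -/
noncomputable def polygonAngle (u : ℕ → Space) (k : ℕ) : ℝ :=
  angle (tangentPart (u (k + 1)) (u k)) (tangentPart (u (k + 1)) (u (k + 2)))

/-- The planar comparison angle at the apex `u 0` of the triangle `u 0, u k, u (k + 1)`. -/
noncomputable def fanAngle (u : ℕ → Space) (k : ℕ) : ℝ :=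
  planarAngle (angle (u 0) (u k)) (angle (u 0) (u (k + 1))) (angle (u k) (u (k + 1)))

/-- The planar comparison angle at `u k` of the triangle `u 0, u k, u (k + 1)`. -/
noncomputable def nextAngle (u : ℕ → Space) (k : ℕ) : ℝ :=
  planarAngle (angle (u 0) (u k)) (angle (u k) (u (k + 1))) (angle (u 0) (u (k + 1)))

/-- The planar comparison angle at `u (k + 1)` of the triangle `u 0, u k, u (k + 1)`. -/
noncomputable def prevAngle (u : ℕ → Space) (k : ℕ) : ℝ :=
  planarAngle (angle (u 0) (u (k + 1))) (angle (u k) (u (k + 1))) (angle (u 0) (u k))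

/-- The sum of the comparison angles at the apex, up to the ray through `u k`. -/
noncomputable def fanSum (u : ℕ → Space) (k : ℕ) : ℝ := ∑ i ∈ Finset.Ico 1 k, fanAngle u i

/-- The direction of the `k`-th edge of the planar comparison polygon. -/
noncomputable def fanDirection (u : ℕ → Space) (k : ℕ) : ℝ :=
  if k = 0 then 0 else fanSum u k + Real.pi - nextAngle u k

namespace IsClosedConvexPolygon

variable {n : ℕ} {u : ℕ → Space}

theorem angle_pos (h : IsClosedConvexPolygon n u) {k : ℕ} (hk : 1 ≤ k) (hkn : k ≤ n) :
    0 < angle (u 0) (u k) :=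
  angle_pos_of_ne (h.norm 0) (h.norm k) (h.ne_zero k hk hkn)

theorem edge_pos (h : IsClosedConvexPolygon n u) {k : ℕ} (hkn : k ≤ n) :
    0 < angle (u k) (u (k + 1)) :=
  angle_pos_of_ne (h.norm k) (h.norm (k + 1)) (h.succ_ne k hkn)

theorem ne_neg_one (h : IsClosedConvexPolygon n u) : u 1 ≠ -u 0 := h.succ_ne_neg 0 (Nat.zero_le n)

theorem ne_neg_last (h : IsClosedConvexPolygon n u) : u n ≠ -u 0 := fun e => by
  have := h.succ_ne_neg n le_rfl
  rw [h.closed, e, neg_neg] at this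
  exact this rfl

theorem convex_zero (h : IsClosedConvexPolygon n u) {k : ℕ} (hk : k ≤ n) :
    0 ≤ sphereSide (u 0) (u k) (u (k + 1)) := by
  rw [sphereSide_rotate]; exact h.convex k hk 0

theorem convex_last (h : IsClosedConvexPolygon n u) (j : ℕ) :
    0 ≤ sphereSide (u 0) (u j) (u n) := by
  have := h.convex n le_rfl j
  rwa [h.closed, sphereSide_rotate] at this

theorem pos' (h : IsClosedConvexPolygon n u) : 0 < sphereSide (u 0) (u 1) (u n) := by
  have := h.pos
  rwa [sphereSide_rotate] at this

theorem fanAngle_add (h : IsClosedConvexPolygon n u) {k : ℕ} (hk : 1 ≤ k) (hkn : k < n) :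
    fanAngle u k + prevAngle u k + nextAngle u k = Real.pi := by
  have t1 := angle_le_angle_add_angle (u 0) (u k) (u (k + 1))
  have t2 := angle_le_angle_add_angle (u 0) (u (k + 1)) (u k)
  have t3 := angle_le_angle_add_angle (u k) (u 0) (u (k + 1))
  rw [angle_comm (u (k + 1)) (u k)] at t2
  rw [angle_comm (u k) (u 0)] at t3
  exact planarAngle_sum (h.angle_pos hk hkn.le) (h.angle_pos (by omega) hkn) (h.edge_pos hkn.le)
    (by linarith) (by linarith) (by linarith)

/-- These are the components, along and across the ray through the `k`-th vertex, that make
consecutive planar triangles fit together in `sum_mul_cos_fanDirection_aux`. -/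
theorem fan_cos (h : IsClosedConvexPolygon n u) {k : ℕ} (hk : 1 ≤ k) (hkn : k < n) :
    angle (u 0) (u (k + 1)) * Real.cos (fanAngle u k) +
      angle (u k) (u (k + 1)) * Real.cos (nextAngle u k) = angle (u 0) (u k) ∧
    angle (u 0) (u (k + 1)) * Real.sin (fanAngle u k) =
      angle (u k) (u (k + 1)) * Real.sin (nextAngle u k) := by
  have t1 := angle_le_angle_add_angle (u 0) (u k) (u (k + 1))
  have t2 := angle_le_angle_add_angle (u 0) (u (k + 1)) (u k)
  have t3 := angle_le_angle_add_angle (u k) (u 0) (u (k + 1))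
  rw [angle_comm (u (k + 1)) (u k)] at t2
  rw [angle_comm (u k) (u 0)] at t3
  exact ⟨mul_cos_planarAngle (h.angle_pos hk hkn.le) (h.angle_pos (by omega) hkn)
    (h.edge_pos hkn.le) (by linarith) (by linarith) (by linarith),
    mul_sin_planarAngle (h.angle_pos hk hkn.le) (h.angle_pos (by omega) hkn)
    (h.edge_pos hkn.le) (by linarith) (by linarith) (by linarith)⟩

theorem fanSum_succ {k : ℕ} (hk : 1 ≤ k) : fanSum u (k + 1) = fanSum u k + fanAngle u k :=
  Finset.sum_Ico_succ_top hk _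

theorem fanSum_one : fanSum u 1 = 0 := by simp [fanSum]

theorem nextAngle_last (h : IsClosedConvexPolygon n u) : nextAngle u n = 0 := by
  have e : angle (u 0) (u (n + 1)) = 0 := by
    rw [h.closed]; exact angle_self (norm_ne_zero_iff.1 (by rw [h.norm]; exact one_ne_zero))
  have e' : angle (u n) (u (n + 1)) = angle (u 0) (u n) := by rw [h.closed, angle_comm]
  have hp := h.angle_pos (by have := h.two_le; omega) (le_refl n)
  rw [nextAngle, e, e', planarAngle, Real.arccos_eq_zero, le_div_iff₀ (by positivity)]
  nlinarith

theorem prevAngle_zero (h : IsClosedConvexPolygon n u) : prevAngle u 0 = 0 := by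
  have e : angle (u 0) (u 0) = 0 :=
    angle_self (norm_ne_zero_iff.1 (by rw [h.norm]; exact one_ne_zero))
  have hp := h.edge_pos (Nat.zero_le n)
  rw [prevAngle, e, planarAngle, Real.arccos_eq_zero, le_div_iff₀ (by positivity)]
  nlinarith

/-- The direction of an edge can be read at its far end, because the angles of the planar triangle
sum to `π`. Comparing with the definition at `k + 1` gives the turn there as `π` minus two
comparison angles. The triangle at `k = 0` is degenerate: `nextAngle u 0` involves a division by
zero, hence the separate case in `fanDirection`. -/
theorem fanDirection_eq (h : IsClosedConvexPolygon n u) {k : ℕ} (hkn : k < n) :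
    fanDirection u k = fanSum u (k + 1) + prevAngle u k := by
  rcases Nat.eq_zero_or_pos k with rfl | hk
  · rw [h.prevAngle_zero, zero_add, fanSum_one]; simp [fanDirection]
  · rw [fanSum_succ hk, fanDirection, if_neg hk.ne']
    linarith [h.fanAngle_add hk hkn]

theorem fanDirection_last (h : IsClosedConvexPolygon n u) :
    fanDirection u n = fanSum u n + Real.pi := by
  have := h.two_le
  rw [fanDirection, if_neg (by omega), h.nextAngle_last, sub_zero]

/-- With the apex at the origin, vertex `m + 1` has polar coordinates `angle (u 0) (u (m + 1))` and
`fanSum u (m + 1)`; both sides are its projection onto the direction `χ`. -/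
theorem sum_mul_cos_fanDirection_aux (h : IsClosedConvexPolygon n u) (χ : ℝ) {m : ℕ}
    (hm : m < n) :
    ∑ k ∈ Finset.range (m + 1), angle (u k) (u (k + 1)) * Real.cos (fanDirection u k - χ) =
      angle (u 0) (u (m + 1)) * Real.cos (fanSum u (m + 1) - χ) := by
  induction m with
  | zero => simp [fanDirection, fanSum]
  | succ m ih =>
    rw [Finset.sum_range_succ, ih (by omega)]
    obtain ⟨hc, hs⟩ := h.fan_cos (k := m + 1) (by omega) hm
    rw [fanSum_succ (k := m + 1) (by omega), fanDirection, if_neg (by omega)]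
    have e1 : fanSum u (m + 1) + Real.pi - nextAngle u (m + 1) - χ =
      (fanSum u (m + 1) - χ) - nextAngle u (m + 1) + Real.pi := by ring
    have e2 : fanSum u (m + 1) + fanAngle u (m + 1) - χ =
      (fanSum u (m + 1) - χ) + fanAngle u (m + 1) := by ring
    rw [e1, e2, Real.cos_add_pi]
    generalize fanSum u (m + 1) - χ = ψ
    rw [Real.cos_sub, Real.cos_add]
    linear_combination -Real.cos ψ * hc + Real.sin ψ * hs

/-- The planar comparison polygon is closed. -/
theorem sum_mul_cos_fanDirection (h : IsClosedConvexPolygon n u) (χ : ℝ) :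
    ∑ k ∈ Finset.range (n + 1), angle (u k) (u (k + 1)) * Real.cos (fanDirection u k - χ) = 0 := by
  have h2 := h.two_le
  obtain ⟨m, rfl⟩ : ∃ m, n = m + 1 := ⟨n - 1, by omega⟩
  rw [Finset.sum_range_succ, h.sum_mul_cos_fanDirection_aux χ (Nat.lt_succ_self m),
    h.fanDirection_last, h.closed, angle_comm (u (m + 1)),
    show fanSum u (m + 1) + Real.pi - χ = (fanSum u (m + 1) - χ) + Real.pi by ring,
    Real.cos_add_pi]
  ring

theorem angle_prev_of_eq_neg (h : IsClosedConvexPolygon n u) {k : ℕ} (hu : u (k + 1) = -u 0) :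
    angle (u 0) (u (k + 1)) = angle (u k) (u (k + 1)) + angle (u 0) (u k) := by
  have h0 : u 0 ≠ 0 := norm_ne_zero_iff.1 (by rw [h.norm]; exact one_ne_zero)
  rw [hu, angle_neg_right, angle_neg_right, angle_comm (u k), angle_self h0]
  ring

theorem angle_next_of_eq_neg (h : IsClosedConvexPolygon n u) {k : ℕ} (hu : u k = -u 0) :
    angle (u 0) (u k) = angle (u k) (u (k + 1)) + angle (u 0) (u (k + 1)) := by
  have h0 : u 0 ≠ 0 := norm_ne_zero_iff.1 (by rw [h.norm]; exact one_ne_zero)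
  rw [hu, angle_neg_right, angle_neg_left, angle_self h0]
  ring

/-- At an interior vertex of the chain, the two comparison angles do not exceed the interior
angle. -/
theorem prevAngle_add_nextAngle_le (h : IsClosedConvexPolygon n u) {k : ℕ} (hkn : k + 1 ≤ n) :
    prevAngle u k + nextAngle u (k + 1) ≤ polygonAngle u k := by
  have h2 := h.two_le
  -- At the antipode of the apex there is no tangent direction to the apex, but both adjacent
  -- comparison triangles are flat and contribute angle `0`.
  by_cases hneg : u (k + 1) = -u 0
  · have hk0 : 1 ≤ k := by
      rcases Nat.eq_zero_or_pos k with rfl | hk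
      · exact (h.ne_neg_one hneg).elim
      · exact hk
    have hkn' : k + 1 < n := lt_of_le_of_ne hkn fun e => h.ne_neg_last (e ▸ hneg)
    rw [prevAngle, h.angle_prev_of_eq_neg hneg, planarAngle_add_eq_zero (h.edge_pos (by omega))
      (h.angle_pos hk0 (by omega)), nextAngle, h.angle_next_of_eq_neg hneg,
      add_comm, add_comm (angle (u (k + 1)) (u (k + 1 + 1))), planarAngle_comm, add_zero]
    rw [planarAngle_comm, add_comm, planarAngle_add_eq_zero (h.edge_pos (by omega))
      (h.angle_pos (by omega) (by omega))]
    exact angle_nonneg _ _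
  have n0 := h.norm 0
  have nk := h.norm k
  have n1 := h.norm (k + 1)
  have n2 := h.norm (k + 2)
  have z1 : u 0 ≠ u (k + 1) := (h.ne_zero (k + 1) (by omega) hkn).symm
  have z2 : u 0 ≠ -u (k + 1) := fun e => hneg (by rw [e, neg_neg])
  have p1 : u k ≠ u (k + 1) := (h.succ_ne k (by omega)).symm
  have p2 : u k ≠ -u (k + 1) := fun e => h.succ_ne_neg k (by omega) (by rw [e, neg_neg])
  have q1 : u (k + 2) ≠ u (k + 1) := h.succ_ne (k + 1) hkn
  have q2 : u (k + 2) ≠ -u (k + 1) := h.succ_ne_neg (k + 1) hkn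
  have hprev : prevAngle u k ≤
      angle (tangentPart (u (k + 1)) (u 0)) (tangentPart (u (k + 1)) (u k)) := by
    have := planarAngle_le_angle n1 n0 nk z1 z2 p1 p2
    rwa [angle_comm (u (k + 1)) (u 0), angle_comm (u (k + 1)) (u k)] at this
  have hnext : nextAngle u (k + 1) ≤
      angle (tangentPart (u (k + 1)) (u (k + 2))) (tangentPart (u (k + 1)) (u 0)) := by
    have := planarAngle_le_angle n1 n0 n2 z1 z2 q1 q2
    rw [angle_comm (u (k + 1)) (u 0)] at this
    rwa [angle_comm (tangentPart (u (k + 1)) (u (k + 2)))]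
  rcases Nat.eq_zero_or_pos k with rfl | hk
  · rw [h.prevAngle_zero, polygonAngle, angle_comm]; linarith
  rcases hkn.eq_or_lt with he | hlt
  · have e : u (k + 2) = u 0 := by rw [← h.closed, ← he]
    rw [he, h.nextAngle_last, polygonAngle, e, angle_comm]; linarith
  have s1 : 0 ≤ sphereSide (u (k + 1)) (u (k + 2)) (u 0) := h.convex (k + 1) hkn 0
  have s2 : 0 ≤ sphereSide (u (k + 1)) (u 0) (u k) := by
    rw [← sphereSide_rotate]; exact h.convex k (by omega) 0
  have s3 : 0 ≤ sphereSide (u (k + 1)) (u (k + 2)) (u k) := h.convex (k + 1) hkn k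
  rcases angle_tangentPart_add n1 n2 n0 nk q1 q2 z1 z2 p1 p2 s1 s2 s3 with hadd | ⟨hx, hy⟩
  · rw [polygonAngle, angle_comm, ← hadd]; linarith
  -- If both angles were `π`, the great circle of the edge leaving `u (k + 1)` would also carry the
  -- preceding edge, with the polygon on opposite sides of it. Every vertex would then lie on that
  -- circle.
  · exfalso
    obtain ⟨r, hr, hr'⟩ := exists_neg_of_angle_tangentPart_eq_pi hx
    obtain ⟨s, hs, hs'⟩ := exists_neg_of_angle_tangentPart_eq_pi hy
    have hz : ∀ j, sphereSide (u (k + 1)) (u (k + 2)) (u j) = 0 := by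
      intro j
      have c1 : 0 ≤ sphereSide (u (k + 1)) (u (k + 2)) (u j) := h.convex (k + 1) hkn j
      have c2 : 0 ≤ -sphereSide (u (k + 1)) (u k) (u j) := by
        have := h.convex k (by omega) j
        rw [sphereSide_rotate, sphereSide_swap] at this
        exact this
      rw [hs', hr'] at c2
      have : 0 < s * r := mul_pos_of_neg_of_neg hs hr
      nlinarith
    exact exists_sphereSide_ne_zero n1 n2 q1 q2 h.pos.ne' (hz _) (hz _) (hz _)

/-- A direction opposite to that of `u 1` would put `u k` strictly on the wrong side of the last
edge. This excludes the exceptional case of angle addition at the apex. -/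
theorem angle_one_lt_pi (h : IsClosedConvexPolygon n u) (k : ℕ) :
    angle (tangentPart (u 0) (u 1)) (tangentPart (u 0) (u k)) < Real.pi := by
  refine lt_of_le_of_ne (angle_le_pi _ _) fun e => ?_
  obtain ⟨r, hr, hr'⟩ := exists_neg_of_angle_tangentPart_eq_pi e
  have h1 := h.convex_last k
  rw [hr'] at h1
  nlinarith [h.pos']

theorem angle_one_add (h : IsClosedConvexPolygon n u) {k m : ℕ} (hk : 1 ≤ k) (hkn : k ≤ n)
    (hm : 1 ≤ m) (hmn : m ≤ n) (hk' : u k ≠ -u 0) (hm' : u m ≠ -u 0)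
    (hkm : 0 ≤ sphereSide (u 0) (u k) (u m)) :
    angle (tangentPart (u 0) (u 1)) (tangentPart (u 0) (u k)) +
      angle (tangentPart (u 0) (u k)) (tangentPart (u 0) (u m)) =
      angle (tangentPart (u 0) (u 1)) (tangentPart (u 0) (u m)) := by
  have h2 := h.two_le
  refine (angle_tangentPart_add (h.norm 0) (h.norm 1) (h.norm k) (h.norm m)
    (h.ne_zero 1 le_rfl (by omega)) h.ne_neg_one (h.ne_zero k hk hkn) hk' (h.ne_zero m hm hmn) hm'
    (h.convex 0 (Nat.zero_le n) k) hkm (h.convex 0 (Nat.zero_le n) m)).resolve_right fun e => ?_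
  exact (h.angle_one_lt_pi k).ne e.1

/-- Strictness appears with the first triangle of nonzero spherical angle at the apex and then
persists; until then both sums are `0`. When `u k` is the antipode of the apex its direction is
undefined, so the statement falls back on the preceding vertex. The two flat triangles at the
antipode add nothing to the planar sum, and the induction steps over them. -/
theorem fanSum_lt_or (h : IsClosedConvexPolygon n u) {k : ℕ} (hk : 1 ≤ k) (hkn : k ≤ n) :
    (u k ≠ -u 0 → fanSum u k < angle (tangentPart (u 0) (u 1)) (tangentPart (u 0) (u k)) ∨
      fanSum u k = 0 ∧ angle (tangentPart (u 0) (u 1)) (tangentPart (u 0) (u k)) = 0) ∧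
    (u k = -u 0 → ∃ m, 1 ≤ m ∧ k = m + 1 ∧ u m ≠ -u 0 ∧ fanSum u k = fanSum u m ∧
      (fanSum u m < angle (tangentPart (u 0) (u 1)) (tangentPart (u 0) (u m)) ∨
      fanSum u m = 0 ∧ angle (tangentPart (u 0) (u 1)) (tangentPart (u 0) (u m)) = 0)) := by
  have h2 := h.two_le
  induction k, hk using Nat.le_induction with
  | base =>
    refine ⟨fun _ => Or.inr ⟨fanSum_one, angle_self ?_⟩, fun e => (h.ne_neg_one e).elim⟩
    exact tangentPart_ne_zero (h.norm 0) (h.norm 1) (h.ne_zero 1 le_rfl (by omega)) h.ne_neg_one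
  | succ k hk ih =>
    obtain ⟨ih1, ih2⟩ := ih (by omega)
    constructor
    · intro hk1
      rw [fanSum_succ hk]
      by_cases hneg : u k = -u 0
      · obtain ⟨m, hm, rfl, hm', e, hlt⟩ := ih2 hneg
        have hz : fanAngle u (m + 1) = 0 := by
          rw [fanAngle, h.angle_next_of_eq_neg hneg, add_comm, planarAngle_add_eq_zero
            (h.angle_pos (by omega) hkn) (h.edge_pos (by omega))]
        have hs : 0 ≤ sphereSide (u 0) (u m) (u (m + 1 + 1)) := by
          have := h.convex m (by omega) (m + 1 + 1)
          rw [hneg, sphereSide_rotate, sphereSide_neg_left, sphereSide_swap, neg_neg] at this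
          exact this
        have hadd := h.angle_one_add hm (by omega) (by omega) hkn hm' hk1 hs
        have h0 := angle_nonneg (tangentPart (u 0) (u m)) (tangentPart (u 0) (u (m + 1 + 1)))
        rw [e, hz, add_zero]
        rcases hlt with hlt | ⟨hz1, hz2⟩
        · left; linarith
        · rcases h0.eq_or_lt with h0 | h0
          · right; exact ⟨hz1, by linarith⟩
          · left; linarith
      · have hadd := h.angle_one_add hk (by omega) (by omega) hkn hneg hk1
          (h.convex_zero (by omega))
        have h0 := angle_nonneg (tangentPart (u 0) (u k)) (tangentPart (u 0) (u (k + 1)))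
        have hle : fanAngle u k ≤ _ := planarAngle_le_angle (h.norm 0) (h.norm k) (h.norm (k + 1))
          (h.ne_zero k hk (by omega)) hneg (h.ne_zero (k + 1) (by omega) hkn) hk1
        have hA0 : 0 ≤ fanAngle u k := planarAngle_nonneg _ _ _
        rcases ih1 hneg with hlt | ⟨hz1, hz2⟩
        · left; linarith
        · rcases h0.eq_or_lt with h0 | h0
          · right; exact ⟨by linarith, by linarith⟩
          · left
            have hlt : fanAngle u k < _ := planarAngle_lt_angle (h.norm 0) (h.norm k)
              (h.norm (k + 1)) (h.ne_zero k hk (by omega)) hneg (h.ne_zero (k + 1) (by omega) hkn)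
              hk1 h0 (by linarith [h.angle_one_lt_pi (k + 1)])
            linarith
    · intro hneg
      have hk1 : u k ≠ -u 0 := fun e => h.succ_ne k (by omega) (by rw [hneg, e])
      refine ⟨k, hk, rfl, hk1, ?_, ih1 hk1⟩
      rw [fanSum_succ hk, fanAngle, planarAngle_comm, h.angle_prev_of_eq_neg hneg, add_comm
        (angle (u k) _), planarAngle_add_eq_zero (h.angle_pos hk (by omega)) (h.edge_pos (by omega)),
        add_zero]

/-- At the apex, the comparison angles sum to less than the interior angle. -/
theorem fanSum_last_lt (h : IsClosedConvexPolygon n u) :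
    fanSum u n < angle (tangentPart (u 0) (u n)) (tangentPart (u 0) (u 1)) := by
  have h2 := h.two_le
  rw [angle_comm]
  refine ((h.fanSum_lt_or (by omega) le_rfl).1 h.ne_neg_last).resolve_right fun e => ?_
  exact (sphereSide_tangentPart_pos_angle h.pos'.ne').1.ne' e.2

theorem le_fanDirection_sub (h : IsClosedConvexPolygon n u) {k : ℕ} (hkn : k < n) :
    Real.pi - polygonAngle u k ≤ fanDirection u (k + 1) - fanDirection u k := by
  rw [h.fanDirection_eq hkn, fanDirection, if_neg (by omega)]
  linarith [h.prevAngle_add_nextAngle_le (k := k) (by omega)]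

theorem lt_fanDirection_sub (h : IsClosedConvexPolygon n u) :
    Real.pi - angle (tangentPart (u 0) (u n)) (tangentPart (u 0) (u 1)) <
      fanDirection u 0 + 2 * Real.pi - fanDirection u n := by
  rw [h.fanDirection_last, fanDirection, if_pos rfl]
  linarith [h.fanSum_last_lt]

theorem fanDirection_mono (h : IsClosedConvexPolygon n u) {j k : ℕ} (hjk : j ≤ k) (hkn : k ≤ n) :
    fanDirection u j ≤ fanDirection u k := by
  induction k, hjk using Nat.le_induction with
  | base => exact le_rfl
  | succ k _ ih =>
    have h1 := h.le_fanDirection_sub (k := k) (by omega)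
    have h2 : polygonAngle u k ≤ Real.pi := angle_le_pi _ _
    linarith [ih (by omega)]

theorem fanDirection_last_lt (h : IsClosedConvexPolygon n u) :
    fanDirection u n < fanDirection u 0 + 2 * Real.pi := by
  linarith [h.lt_fanDirection_sub, angle_le_pi (tangentPart (u 0) (u n)) (tangentPart (u 0) (u 1))]

end IsClosedConvexPolygon

end

/-! ### The arm lemma in terms of edge directions -/

section

open InnerProductGeometry

/-- If the directions `τ` turn at most as fast as the increasing
angles `f`, and strictly slower somewhere, then in a suitable frame they are at most `|f|`. -/
theorem exists_abs_sub_le_abs {n : ℕ} {τ f : ℕ → ℝ}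
    (h : ∀ i, i + 1 < n → |τ (i + 1) - τ i| ≤ f (i + 1) - f i)
    (hs : ∃ i, i + 1 < n ∧ |τ (i + 1) - τ i| < f (i + 1) - f i) :
    ∃ ε, (∀ i < n, |τ i - ε| ≤ |f i|) ∧ ∃ i < n, |τ i - ε| < |f i| := by
  obtain ⟨s, hsn, hs⟩ := hs
  -- Since `τ + f` increases and `τ - f` decreases, the constraints on `ε` are tightest at the two
  -- indices on either side of the sign change of `f`.
  have mono : ∀ i j, i ≤ j → j < n → τ i + f i ≤ τ j + f j ∧ τ j - f j ≤ τ i - f i := by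
    intro i j hij hj
    induction j, hij using Nat.le_induction with
    | base => exact ⟨le_rfl, le_rfl⟩
    | succ j _ ih =>
      have h1 := abs_le.1 (h j hj)
      have h2 := ih (by omega)
      exact ⟨by linarith [h1.1], by linarith [h1.2]⟩
  have hs' := abs_lt.1 hs
  have neg_case : ∀ ε i, f i ≤ 0 → τ i + f i ≤ ε → ε ≤ τ i - f i → |τ i - ε| ≤ |f i| := by
    intro ε i h0 h1 h2
    rw [abs_of_nonpos h0, abs_le]
    exact ⟨by linarith, by linarith⟩
  have pos_case : ∀ ε i, 0 ≤ f i → τ i - f i ≤ ε → ε ≤ τ i + f i → |τ i - ε| ≤ |f i| := by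
    intro ε i h0 h1 h2
    rw [abs_of_nonneg h0, abs_le]
    exact ⟨by linarith, by linarith⟩
  have neg_case' : ∀ ε i, τ i + f i < ε → ε < τ i - f i → |τ i - ε| < |f i| := by
    intro ε i h1 h2
    rw [abs_of_nonpos (a := f i) (by linarith), abs_lt]
    exact ⟨by linarith, by linarith⟩
  have pos_case' : ∀ ε i, τ i - f i < ε → ε < τ i + f i → |τ i - ε| < |f i| := by
    intro ε i h1 h2
    rw [abs_of_nonneg (a := f i) (by linarith), abs_lt]
    exact ⟨by linarith, by linarith⟩
  -- a frame in which the arm is bisected at the place where `f` changes sign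
  obtain ⟨m, hmn, hneg, hpos⟩ : ∃ m ≤ n, (∀ i < m, f i < 0) ∧ ∀ i, m ≤ i → i < n → 0 ≤ f i := by
    by_cases hex : ∃ i, i < n ∧ 0 ≤ f i
    · classical
      refine ⟨Nat.find hex, (Nat.find_spec hex).1.le, fun i hi => ?_, fun i hi hin => ?_⟩
      · have := Nat.find_min hex hi
        push Not at this
        exact this (hi.trans (Nat.find_spec hex).1)
      · have := mono _ _ hi hin
        linarith [(Nat.find_spec hex).2]
    · push Not at hex
      exact ⟨n, le_rfl, hex, fun i hi hin => by omega⟩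
  obtain ⟨ε, h1, h2, h3⟩ : ∃ ε, (∀ i < m, τ i + f i ≤ ε ∧ ε ≤ τ i - f i) ∧
      (∀ i, m ≤ i → i < n → τ i - f i ≤ ε ∧ ε ≤ τ i + f i) ∧
      (s + 1 = m → τ s + f s < ε ∧ ε < τ s - f s) := by
    rcases Nat.eq_zero_or_pos m with rfl | hm0
    · refine ⟨τ 0, fun i hi => by omega, fun i hi hin => ?_, fun e => by omega⟩
      have := mono 0 i hi hin
      have := hpos 0 le_rfl (by omega)
      exact ⟨by linarith, by linarith⟩
    obtain ⟨m, rfl⟩ : ∃ m', m = m' + 1 := ⟨m - 1, by omega⟩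
    have hm := hneg m (Nat.lt_succ_self m)
    rcases hmn.eq_or_lt with rfl | hlt
    · refine ⟨τ m, fun i hi => ?_, fun i hi hin => by omega, fun e => by omega⟩
      have := mono i m (by omega) (Nat.lt_succ_self m)
      exact ⟨by linarith, by linarith⟩
    · have hp := hpos (m + 1) le_rfl hlt
      have hmm := mono m (m + 1) (Nat.le_succ m) hlt
      -- The two tightest constraints are intervals that meet. The midpoint of their intersection,
      -- rather than an endpoint, keeps the inequality strict when the strict step is the sign
      -- change itself.
      refine ⟨(max (τ m + f m) (τ (m + 1) - f (m + 1)) +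
        min (τ m - f m) (τ (m + 1) + f (m + 1))) / 2, ?_⟩
      set lo := max (τ m + f m) (τ (m + 1) - f (m + 1)) with hlo
      set hi := min (τ m - f m) (τ (m + 1) + f (m + 1)) with hhi
      have hlh : lo ≤ hi := max_le (le_min (by linarith) (by linarith))
        (le_min (by linarith) (by linarith))
      have l1 : τ m + f m ≤ lo := le_max_left _ _
      have l2 : τ (m + 1) - f (m + 1) ≤ lo := le_max_right _ _
      have r1 : hi ≤ τ m - f m := min_le_left _ _
      have r2 : hi ≤ τ (m + 1) + f (m + 1) := min_le_right _ _
      refine ⟨fun i hi' => ?_, fun i hi' hin => ?_, fun e => ?_⟩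
      · have := mono i m (by omega) (by omega)
        exact ⟨by linarith, by linarith⟩
      · have := mono (m + 1) i hi' hin
        exact ⟨by linarith, by linarith⟩
      · obtain rfl : s = m := by omega
        have a1 : τ s + f s < hi := lt_min (by linarith) (by linarith)
        have a2 : lo < τ s - f s := max_lt (by linarith) (by linarith)
        exact ⟨by linarith, by linarith⟩
  refine ⟨ε, fun i hi => ?_, ?_⟩
  · rcases lt_or_ge i m with him | him
    · exact neg_case ε i (hneg i him).le (h1 i him).1 (h1 i him).2
    · exact pos_case ε i (hpos i him hi) (h2 i him hi).1 (h2 i him hi).2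
  · rcases lt_trichotomy (s + 1) m with hlt | he | hgt
    · have := h1 (s + 1) hlt
      exact ⟨s, by omega, neg_case' ε s (by linarith) (by linarith)⟩
    · exact ⟨s, by omega, neg_case' ε s (h3 he).1 (h3 he).2⟩
    · have := h2 s (by omega) (by omega)
      exact ⟨s + 1, hsn, pos_case' ε (s + 1) (by linarith) (by linarith)⟩

theorem exists_lt_sum_mul_cos {n : ℕ} {L τ f : ℕ → ℝ} (hL : ∀ i < n, 0 < L i)
    (hf : ∀ i < n, |f i| ≤ Real.pi)
    (h : ∀ i, i + 1 < n → |τ (i + 1) - τ i| ≤ f (i + 1) - f i)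
    (hs : ∃ i, i + 1 < n ∧ |τ (i + 1) - τ i| < f (i + 1) - f i) :
    ∃ ε, ∑ i ∈ Finset.range n, L i * Real.cos (f i) <
      ∑ i ∈ Finset.range n, L i * Real.cos (τ i - ε) := by
  obtain ⟨ε, hle, j, hj, hlt⟩ := exists_abs_sub_le_abs h hs
  refine ⟨ε, Finset.sum_lt_sum (fun i hi => ?_) ⟨j, Finset.mem_range.2 hj, ?_⟩⟩
  · have hi := Finset.mem_range.1 hi
    refine mul_le_mul_of_nonneg_left ?_ (hL i hi).le
    rw [← Real.cos_abs (f i), ← Real.cos_abs (τ i - ε)]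
    exact Real.cos_le_cos_of_nonneg_of_le_pi (abs_nonneg _) (hf i hi) (hle i hi)
  · refine mul_lt_mul_of_pos_left ?_ (hL j hj)
    rw [← Real.cos_abs (f j), ← Real.cos_abs (τ j - ε)]
    exact Real.cos_lt_cos_of_nonneg_of_le_pi (abs_nonneg _) (hf j hj) hlt

/-! ### Polar directions of the edges of a planar chain -/

theorem inner_plane (x y : Plane) : inner ℝ x y = x 0 * y 0 + x 1 * y 1 := by
  simp [PiLp.inner_apply, Fin.sum_univ_two, mul_comm]

theorem exists_polar (x : Plane) : ∃ τ, x 0 = ‖x‖ * Real.cos τ ∧ x 1 = ‖x‖ * Real.sin τ := by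
  have h : ‖(⟨x 0, x 1⟩ : ℂ)‖ = ‖x‖ := by
    rw [EuclideanSpace.norm_eq, Fin.sum_univ_two, Complex.norm_def, Complex.normSq_mk]
    simp [pow_two]
  refine ⟨Complex.arg ⟨x 0, x 1⟩, ?_, ?_⟩
  · rw [← h, Complex.norm_mul_cos_arg]
  · rw [← h, Complex.norm_mul_sin_arg]

theorem exists_polar_near {x : Plane} (hx : x ≠ 0) (y : Plane) {τ : ℝ}
    (h0 : x 0 = ‖x‖ * Real.cos τ)
    (h1 : x 1 = ‖x‖ * Real.sin τ) :
    ∃ σ, (y 0 = ‖y‖ * Real.cos σ ∧ y 1 = ‖y‖ * Real.sin σ) ∧ |σ - τ| ≤ angle x y := by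
  by_cases hy : y = 0
  · exact ⟨τ, by simp [hy], by simp [angle_nonneg]⟩
  obtain ⟨σ, hσ0, hσ1⟩ := exists_polar y
  have nx : 0 < ‖x‖ := norm_pos_iff.2 hx
  have ny : 0 < ‖y‖ := norm_pos_iff.2 hy
  have hcos : Real.cos (angle x y) = Real.cos (σ - τ) := by
    have h := cos_angle_mul_norm_mul_norm x y
    rw [inner_plane, h0, h1, hσ0, hσ1] at h
    apply mul_right_cancel₀ (mul_pos nx ny).ne'
    rw [h, Real.cos_sub]; ring
  obtain ⟨k, hk⟩ := Real.cos_eq_cos_iff.1 hcos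
  refine ⟨σ - 2 * k * Real.pi, ⟨?_, ?_⟩, ?_⟩
  · rw [hσ0, show σ - 2 * k * Real.pi = σ - k * (2 * Real.pi) by ring, Real.cos_sub_int_mul_two_pi]
  · rw [hσ1, show σ - 2 * k * Real.pi = σ - k * (2 * Real.pi) by ring, Real.sin_sub_int_mul_two_pi]
  · have : 0 ≤ angle x y := angle_nonneg _ _
    rcases hk with hk | hk
    · rw [show σ - 2 * k * Real.pi - τ = angle x y by linarith, abs_of_nonneg this]
    · rw [show σ - 2 * k * Real.pi - τ = -angle x y by linarith, abs_neg, abs_of_nonneg this]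

theorem exists_polar_seq (E : ℕ → Plane) :
    ∃ τ : ℕ → ℝ, (∀ i, E i 0 = ‖E i‖ * Real.cos (τ i) ∧ E i 1 = ‖E i‖ * Real.sin (τ i)) ∧
      ∀ i, E i ≠ 0 → |τ (i + 1) - τ i| ≤ angle (E i) (E (i + 1)) := by
  -- The condition that `t` is an argument of `E i` sits inside the existential, so that `choose`
  -- yields a total function to iterate.
  have step : ∀ i (t : ℝ), ∃ σ, (E i 0 = ‖E i‖ * Real.cos t ∧ E i 1 = ‖E i‖ * Real.sin t) →
      (E (i + 1) 0 = ‖E (i + 1)‖ * Real.cos σ ∧ E (i + 1) 1 = ‖E (i + 1)‖ * Real.sin σ) ∧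
      (E i ≠ 0 → |σ - t| ≤ angle (E i) (E (i + 1))) := by
    intro i t
    by_cases h : E i = 0
    · obtain ⟨σ, hσ⟩ := exists_polar (E (i + 1))
      exact ⟨σ, fun _ => ⟨hσ, fun h' => (h' h).elim⟩⟩
    by_cases ht : E i 0 = ‖E i‖ * Real.cos t ∧ E i 1 = ‖E i‖ * Real.sin t
    · obtain ⟨σ, h1, h2⟩ := exists_polar_near h (E (i + 1)) ht.1 ht.2
      exact ⟨σ, fun _ => ⟨h1, fun _ => h2⟩⟩
    · exact ⟨0, fun h => (ht h).elim⟩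
  choose g hg using step
  obtain ⟨t₀, ht₀⟩ := exists_polar (E 0)
  let τ : ℕ → ℝ := fun i => Nat.rec t₀ (fun i t => g i t) i
  have hτ : ∀ i, E i 0 = ‖E i‖ * Real.cos (τ i) ∧ E i 1 = ‖E i‖ * Real.sin (τ i) := by
    intro i
    induction i with
    | zero => exact ht₀
    | succ i ih => exact (hg i (τ i) ih).1
  exact ⟨τ, hτ, fun i => (hg i (τ i) (hτ i)).2⟩

/-- An arm lemma: if the planar chain `w` turns less than a planar chain with the same edge lengths
whose edges have directions `f i` of absolute value at most `π`, then its endpoints are farther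
apart. -/
theorem sum_mul_cos_lt_dist {n : ℕ} {w : ℕ → Plane} {f : ℕ → ℝ}
    (hw : ∀ i < n, w (i + 1) ≠ w i) (hf : ∀ i < n, |f i| ≤ Real.pi)
    (h : ∀ i, i + 1 < n →
      Real.pi - EuclideanGeometry.angle (w i) (w (i + 1)) (w (i + 2)) ≤ f (i + 1) - f i)
    (hs : ∃ i, i + 1 < n ∧
      Real.pi - EuclideanGeometry.angle (w i) (w (i + 1)) (w (i + 2)) < f (i + 1) - f i) :
    ∑ i ∈ Finset.range n, dist (w i) (w (i + 1)) * Real.cos (f i) < dist (w 0) (w n) := by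
  obtain ⟨τ, hτ, hτ'⟩ := exists_polar_seq fun i => w (i + 1) - w i
  have hE : ∀ i < n, w (i + 1) - w i ≠ 0 := fun i hi => sub_ne_zero.2 (hw i hi)
  have hang : ∀ i, angle (w (i + 1) - w i) (w (i + 1 + 1) - w (i + 1)) =
      Real.pi - EuclideanGeometry.angle (w i) (w (i + 1)) (w (i + 2)) := by
    intro i
    rw [EuclideanGeometry.angle, vsub_eq_sub, vsub_eq_sub, ← neg_sub (w (i + 1)) (w i),
      angle_neg_left]
    ring
  obtain ⟨ε, hε⟩ := exists_lt_sum_mul_cos (n := n) (L := fun i => dist (w i) (w (i + 1)))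
    (τ := τ) (f := f) (fun i hi => dist_pos.2 (hw i hi).symm) hf
    (fun i hi => (hτ' i (hE i (by omega))).trans ((hang i).trans_le (h i hi)))
    (by
      obtain ⟨i, hi, hlt⟩ := hs
      exact ⟨i, hi, (hτ' i (hE i (by omega))).trans_lt ((hang i).trans_lt hlt)⟩)
  refine hε.trans_le ?_
  -- The sum is the projection of `w n - w 0` onto the unit vector of direction `ε`, hence at most
  -- its norm.
  have key : ∑ i ∈ Finset.range n, dist (w i) (w (i + 1)) * Real.cos (τ i - ε) =
      (w n 0 - w 0 0) * Real.cos ε + (w n 1 - w 0 1) * Real.sin ε := by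
    rw [← Finset.sum_range_sub (fun i => w i 0), ← Finset.sum_range_sub (fun i => w i 1),
      Finset.sum_mul, Finset.sum_mul, ← Finset.sum_add_distrib]
    refine Finset.sum_congr rfl fun i _ => ?_
    obtain ⟨h0, h1⟩ := hτ i
    simp only [PiLp.sub_apply] at h0 h1
    rw [h0, h1, dist_comm, dist_eq_norm, Real.cos_sub]
    ring
  rw [key, dist_comm, dist_eq_norm, EuclideanSpace.norm_eq, Fin.sum_univ_two]
  apply Real.le_sqrt_of_sq_le
  simp only [PiLp.sub_apply, Real.norm_eq_abs, sq_abs]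
  nlinarith [sq_nonneg ((w n 0 - w 0 0) * Real.sin ε - (w n 1 - w 0 1) * Real.cos ε),
    Real.sin_sq_add_cos_sq ε]

end

/-! ### Comparing the two arms, choosing the apex, and conclusion -/

section

open InnerProductGeometry

/-- The fan starts at the apex `V c`, the chain at `V 0`. In the fan's numbering, edges `0, …, m -
1` are the part of the chain after the apex, edge `m` is the closing edge, and edges `m + 1, …, m +
c` are the part before the apex. -/
theorem dist_lt_of_isClosedConvexPolygon {R : ℝ} (hR : 0 < R) {c m : ℕ} (hc : 1 ≤ c) (hm : 1 ≤ m)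
    {V : ℕ → Space} (hper : ∀ i, V (i + (c + m + 1)) = V i)
    (hV : IsClosedConvexPolygon (c + m) fun k => V (c + k)) {W : ℕ → Plane}
    (hedge : ∀ i < c + m, dist (W i) (W (i + 1)) = R * angle (V i) (V (i + 1)))
    (hangle : ∀ i, i + 1 < c + m → EuclideanGeometry.angle (W i) (W (i + 1)) (W (i + 2)) =
      polygonAngle V i) :
    R * angle (V 0) (V (c + m)) < dist (W 0) (W (c + m)) := by
  set φ := fanDirection fun k => V (c + k) with hφ
  set χ := φ m with hχ
  -- Directions of the comparison arm relative to its chord, which is opposite to the closing edge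
  -- of direction `χ`. The shifts `π` and `-π` differ by the full turn made on passing the apex, so
  -- `f` increases along the chain and stays in `[-π, π]`.
  obtain ⟨f, hfdef⟩ : ∃ f : ℕ → ℝ, ∀ i, f i =
      if c ≤ i then φ (i - c) - χ + Real.pi else φ (m + 1 + i) - χ - Real.pi := ⟨_, fun _ => rfl⟩
  have hf1 : ∀ k, f (c + k) = φ k - χ + Real.pi := by
    intro k
    rw [hfdef, if_pos (by omega), Nat.add_sub_cancel_left]
  have hf2 : ∀ i < c, f i = φ (m + 1 + i) - χ - Real.pi := by
    intro i hi
    rw [hfdef, if_neg (by omega)]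
  have hshift : ∀ i, V (c + (m + 1 + i)) = V i := by
    intro i
    rw [← hper i]; congr 1; ring
  have hlast := hV.fanDirection_last_lt
  have hmono : ∀ {j k : ℕ}, j ≤ k → k ≤ c + m → φ j ≤ φ k := hV.fanDirection_mono
  have hsum : ∑ i ∈ Finset.range (c + m), dist (W i) (W (i + 1)) * Real.cos (f i) =
      R * angle (V 0) (V (c + m)) := by
    have h0 := hV.sum_mul_cos_fanDirection χ
    rw [show c + m + 1 = m + 1 + c by ring, Finset.sum_range_add, Finset.sum_range_succ] at h0
    have e1 : ∑ i ∈ Finset.range c, dist (W i) (W (i + 1)) * Real.cos (f i) =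
        -R * ∑ j ∈ Finset.range c, angle (V (c + (m + 1 + j))) (V (c + (m + 1 + j + 1))) *
          Real.cos (φ (m + 1 + j) - χ) := by
      rw [Finset.mul_sum]
      refine Finset.sum_congr rfl fun i hi => ?_
      have hi := Finset.mem_range.1 hi
      rw [hf2 i hi, Real.cos_sub_pi, hedge i (by omega), hshift, add_assoc (m + 1), hshift]
      ring
    have e2 : ∑ k ∈ Finset.range m, dist (W (c + k)) (W (c + k + 1)) * Real.cos (f (c + k)) =
        -R * ∑ k ∈ Finset.range m, angle (V (c + k)) (V (c + (k + 1))) *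
          Real.cos (φ k - χ) := by
      rw [Finset.mul_sum]
      refine Finset.sum_congr rfl fun i hi => ?_
      have hi := Finset.mem_range.1 hi
      rw [hf1 i, Real.cos_add_pi, hedge (c + i) (by omega), add_assoc]
      ring
    have e3 : angle (V (c + m)) (V (c + (m + 1))) * Real.cos (φ m - χ) =
        angle (V 0) (V (c + m)) := by
      rw [← hχ, sub_self, Real.cos_zero, mul_one, show c + (m + 1) = c + (m + 1 + 0) by rfl, hshift,
        angle_comm]
    rw [Finset.sum_range_add, e1, e2]
    rw [e3] at h0
    linear_combination -R * h0
  have hcorner : Real.pi - polygonAngle V (c - 1) < f c - f (c - 1) := by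
    have := hV.lt_fanDirection_sub
    rw [show f c = f (c + 0) from rfl, hf1, hf2 (c - 1) (by omega),
      show m + 1 + (c - 1) = c + m by omega]
    have e : polygonAngle V (c - 1) = angle (tangentPart (V (c + 0)) (V (c + (c + m))))
        (tangentPart (V (c + 0)) (V (c + 1))) := by
      have e1 : V (c + (c + m)) = V (c - 1) := by
        rw [← hper (c - 1)]; congr 1; omega
      rw [polygonAngle, e1, show c - 1 + 1 = c + 0 by omega, show c - 1 + 2 = c + 1 by omega]
    rw [e]
    linarith
  rw [← hsum]
  refine sum_mul_cos_lt_dist (fun i hi => ?_) (fun i hi => ?_) (fun i hi => ?_)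
    ⟨c - 1, by omega, ?_⟩
  · have hpos : 0 < angle (V i) (V (i + 1)) := by
      rcases lt_or_ge i c with hic | hic
      · have := hV.edge_pos (k := m + 1 + i) (by omega)
        rwa [hshift, add_assoc (m + 1), hshift] at this
      · obtain ⟨k, rfl⟩ := Nat.exists_eq_add_of_le hic
        exact hV.edge_pos (k := k) (by omega)
    have : 0 < dist (W i) (W (i + 1)) := by
      rw [hedge i hi]; positivity
    exact (dist_pos.1 this).symm
  · rw [abs_le]
    rcases lt_or_ge i c with hic | hic
    · rw [hf2 i hic]
      have h1 := hmono (j := m) (k := m + 1 + i) (by omega) (by omega)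
      have h2 := hmono (j := m + 1 + i) (k := c + m) (by omega) le_rfl
      have h3 := hmono (j := 0) (k := m) (by omega) (by omega)
      constructor <;> linarith
    · obtain ⟨k, rfl⟩ := Nat.exists_eq_add_of_le hic
      rw [hf1 k]
      have h1 := hmono (j := k) (k := m) (by omega) (by omega)
      have h2 := hmono (j := m) (k := c + m) (by omega) le_rfl
      have h3 := hmono (j := 0) (k := k) (by omega) (by omega)
      constructor <;> linarith
  · rw [hangle i hi]
    rcases lt_trichotomy (i + 1) c with hic | hic | hic
    · rw [hf2 i (by omega), hf2 (i + 1) hic]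
      have := hV.le_fanDirection_sub (k := m + 1 + i) (by omega)
      rw [polygonAngle, add_assoc (m + 1), add_assoc (m + 1), hshift, hshift, hshift] at this
      rw [polygonAngle]
      linarith
    · obtain rfl : i = c - 1 := by omega
      rw [hic]
      exact hcorner.le
    · obtain ⟨k, rfl⟩ := Nat.exists_eq_add_of_le (Nat.lt_succ_iff.1 hic)
      rw [add_assoc, hf1 k, hf1 (k + 1)]
      have := hV.le_fanDirection_sub (k := k) (by omega)
      rw [polygonAngle] at this
      rw [polygonAngle]
      simp only [add_assoc] at this ⊢
      linarith
  · rw [hangle (c - 1) (by omega), Nat.sub_add_cancel hc]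
    exact hcorner

/-- A chain not on one great circle has a proper corner. -/
theorem exists_sphereSide_succ_ne_zero {n : ℕ} (hn : 1 ≤ n) {V : ℕ → Space} (hV : ∀ i, ‖V i‖ = 1)
    (hne : ∀ i < n, V (i + 1) ≠ V i) (hne' : ∀ i < n, V (i + 1) ≠ -V i)
    (h : ∃ i ≤ n, ∃ j ≤ n, ∃ k ≤ n, sphereSide (V i) (V j) (V k) ≠ 0) :
    ∃ i, i + 2 ≤ n ∧ sphereSide (V i) (V (i + 1)) (V (i + 2)) ≠ 0 := by
  by_contra! hcon
  -- Without a proper corner each vertex lies on the great circle of the two before it, so the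
  -- induction carries two consecutive vertices.
  have hall : ∀ j, j + 1 ≤ n → sphereSide (V 0) (V 1) (V j) = 0 ∧
      sphereSide (V 0) (V 1) (V (j + 1)) = 0 := by
    intro j hj
    induction j with
    | zero => constructor <;> · simp only [sphereSide_eq]; ring
    | succ j ih =>
      obtain ⟨h1, h2⟩ := ih (by omega)
      exact ⟨h2, sphereSide_eq_zero_of_sphereSide_eq_zero (hV j) (hV (j + 1)) (hne j (by omega))
        (hne' j (by omega)) h1 h2 (hcon j hj)⟩
  have hall' : ∀ j ≤ n, sphereSide (V 0) (V 1) (V j) = 0 := by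
    intro j hj
    rcases hj.eq_or_lt with rfl | hlt
    · obtain ⟨k, rfl⟩ : ∃ k, j = k + 1 := ⟨j - 1, by omega⟩
      exact (hall k le_rfl).2
    · exact (hall j hlt).1
  obtain ⟨i, hi, j, hj, k, hk, hijk⟩ := h
  exact exists_sphereSide_ne_zero (hV 0) (hV 1) (hne 0 hn) (hne' 0 hn) hijk (hall' i hi)
    (hall' j hj) (hall' k hk)

/-- The determinant is cubic in the scale, so a negative factor, that is the antipodal map, turns a
clockwise polygon into a counterclockwise one and preserves all angles. -/
theorem IsConvexSphereChain.exists_scale {R : ℝ} (hR : 0 < R) {n : ℕ} {v : Fin (n + 1) → Sphere R}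
    (hv : IsConvexSphereChain v) : ∃ s : ℝ, s ≠ 0 ∧ (∀ i, ‖s • (v i : Space)‖ = 1) ∧
      ∀ i j, 0 ≤ sphereSide (s • (v i : Space)) (s • (v (i + 1) : Space)) (s • (v j : Space)) := by
  have hnorm : ∀ i, ‖(v i : Space)‖ = R := fun i => by simp
  rcases hv.convex with h | h
  · refine ⟨R⁻¹, by positivity, fun i => ?_, fun i j => ?_⟩
    · rw [norm_smul, hnorm, norm_inv, Real.norm_of_nonneg hR.le, inv_mul_cancel₀ hR.ne']
    · rw [sphereSide_smul]
      exact mul_nonneg (by positivity) (h i j)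
  · refine ⟨-R⁻¹, neg_ne_zero.2 (by positivity), fun i => ?_, fun i j => ?_⟩
    · rw [norm_smul, hnorm, norm_neg, norm_inv, Real.norm_of_nonneg hR.le, inv_mul_cancel₀ hR.ne']
    · rw [sphereSide_smul, show (-R⁻¹) ^ 3 = -(R⁻¹ ^ 3) by ring]
      exact mul_nonneg_of_nonpos_of_nonpos (neg_nonpos.2 (by positivity)) (h i j)

theorem ofNat_add_one (n i : ℕ) : Fin.ofNat (n + 1) (i + 1) = Fin.ofNat (n + 1) i + 1 :=
  Fin.ext (by simp [Fin.val_add])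

theorem ofNat_eq_mk {n i : ℕ} (h : i < n + 1) : Fin.ofNat (n + 1) i = ⟨i, h⟩ :=
  Fin.ext (Nat.mod_eq_of_lt h)

end

theorem theorem2p1 (R : ℝ) (hR : 0 < R) (n : ℕ)
    (v : Fin (n + 1) → Sphere R) (hv : IsConvexSphereChain v)
    (w : Fin (n + 1) → Plane) (hw : IsConvexPlaneChain w)
    (h_edge : ∀ i : Fin n, dist (w i.castSucc) (w i.succ) = sphereDist (v i.castSucc) (v i.succ))
    (h_angle : ∀ i : Fin (n + 1), i ≠ 0 → i ≠ Fin.last n →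
      EuclideanGeometry.angle (w (i - 1)) (w i) (w (i + 1)) =
        sphereAngle (v (i - 1)) (v i) (v (i + 1))) :
    sphereDist (v 0) (v (Fin.last n)) < dist (w 0) (w (Fin.last n)) := by
  obtain ⟨s, hs, hnorm, hconv⟩ := hv.exists_scale hR
  have hn : 1 ≤ n := by
    by_contra hn
    obtain rfl : n = 0 := by omega
    obtain ⟨i, j, k, hijk⟩ := hv.nondegenerate
    apply hijk
    rw [show j = i by omega, show k = i by omega, sphereSide_eq]
    ring
  have hinj : ∀ i j, s • (v i : Space) = s • (v j : Space) → i = j := fun i j h =>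
    hv.injective (Subtype.ext (smul_right_injective _ hs h))
  obtain ⟨V, hVdef⟩ : ∃ V : ℕ → Space, ∀ i, V i = s • (v (Fin.ofNat (n + 1) i) : Space) :=
    ⟨_, fun _ => rfl⟩
  have hper : ∀ i, V (i + (n + 1)) = V i := by
    intro i
    rw [hVdef, hVdef]
    congr 3
    exact Fin.ext (Nat.add_mod_right _ _)
  have hcast : ∀ i : Fin (n + 1), V i = s • (v i : Space) := fun i => by
    rw [hVdef, ofNat_eq_mk i.isLt]
  have hVnorm : ∀ i, ‖V i‖ = 1 := fun i => by rw [hVdef]; exact hnorm _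
  have hVconv : ∀ i j, 0 ≤ sphereSide (V i) (V (i + 1)) (V j) := fun i j => by
    rw [hVdef, hVdef, hVdef, ofNat_add_one]; exact hconv _ _
  have hVne : ∀ i k, 1 ≤ k → k ≤ n → V (i + k) ≠ V i := by
    intro i k hk hkn e
    rw [hVdef, hVdef] at e
    have hmod : i + k ≡ i + 0 [MOD n + 1] := congrArg Fin.val (hinj _ _ e)
    have := Nat.ModEq.add_left_cancel' i hmod
    exact absurd (Nat.le_of_dvd (by omega) ((Nat.modEq_zero_iff_dvd).1 this)) (by omega)
  have hVneg : ∀ i, V (i + 1) ≠ -V i := by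
    intro i e
    rw [hVdef, hVdef, ofNat_add_one, ← smul_neg] at e
    exact hv.not_antipodal _ (smul_right_injective _ hs e)
  -- The proper corner is at `i + 1`, which becomes the apex of the fan.
  obtain ⟨i, hin, hi⟩ := exists_sphereSide_succ_ne_zero hn hVnorm
    (fun i _ => hVne i 1 le_rfl hn) (fun i _ => hVneg i) (by
      obtain ⟨i, j, k, hijk⟩ := hv.nondegenerate
      refine ⟨i, by omega, j, by omega, k, by omega, ?_⟩
      rw [hcast, hcast, hcast, sphereSide_smul]
      exact mul_ne_zero (pow_ne_zero 3 hs) hijk)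
  obtain ⟨m, rfl⟩ := Nat.exists_eq_add_of_le hin
  have hpoly : IsClosedConvexPolygon (i + 1 + (m + 1)) fun k => V (i + 1 + k) := by
    refine ⟨by omega, fun k => hVnorm _, ?_, fun k _ j => hVconv _ _, fun k _ => ?_,
      fun k _ => hVneg _, fun k hk hkn => ?_, ?_⟩
    · rw [← hper (i + 1 + 0)]; congr 1; omega
    · exact hVne _ 1 le_rfl hn
    · exact hVne _ k hk (by omega)
    · refine lt_of_le_of_ne ?_ ?_
      · have := hVconv (i + 1 + (i + 1 + (m + 1))) (i + 1 + 1)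
        have e : V (i + 1 + (i + 1 + (m + 1)) + 1) = V (i + 1 + 0) := by
          rw [← hper (i + 1 + 0)]; congr 1; omega
        rwa [e] at this
      · have e : V (i + 1 + (i + 1 + (m + 1))) = V i := by
          rw [← hper i]; congr 1; omega
        rw [e]
        exact hi.symm
  have key := dist_lt_of_isClosedConvexPolygon hR (c := i + 1) (m := m + 1) (by omega) (by omega)
    (V := V) (fun j => by rw [← hper j]; congr 1; omega) hpoly
    (W := fun j => w (Fin.ofNat (i + 2 + m + 1) j)) (fun j hj => ?_) (fun j hj => ?_)
  · rw [show i + 1 + (m + 1) = i + 2 + m by omega, hVdef, hVdef,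
      InnerProductGeometry.angle_smul_smul hs] at key
    rw [ofNat_eq_mk (Nat.lt_succ_self _), ofNat_eq_mk (Nat.succ_pos _)] at key
    exact key
  · have := h_edge ⟨j, by omega⟩
    rw [hVdef, hVdef, InnerProductGeometry.angle_smul_smul hs, ofNat_eq_mk (i := j) (by omega),
      ofNat_eq_mk (i := j + 1) (by omega)]
    exact this
  · have := h_angle (Fin.ofNat (i + 2 + m + 1) (j + 1))
      (by
        rw [ofNat_eq_mk (by omega), Ne, Fin.ext_iff]
        simp)
      (by
        rw [ofNat_eq_mk (by omega), Ne, Fin.ext_iff, Fin.val_last]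
        simp only
        omega)
    have e : Fin.ofNat (i + 2 + m + 1) (j + 1) - 1 = Fin.ofNat (i + 2 + m + 1) j := by
      rw [ofNat_add_one, add_sub_cancel_right]
    rw [e, ← ofNat_add_one, sphereAngle] at this
    rw [polygonAngle, hVdef, hVdef, hVdef, tangentPart_smul hs, tangentPart_smul hs,
      InnerProductGeometry.angle_smul_smul hs]
    exact this
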